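/- For $x\in\mathbb R^3$ let $x^\times$ be the skew-symmetric matrix with $x^\times y=x\times y$, and let $\mathrm{vex}$ be the inverse map. Let $k\ge 2$. A measurement at one instant consists of inertial vectors $e_1,\dots,e_k\in\mathbb R^3$, measured body vectors $u^m_1,\dots,u^m_k\in\mathbb R^3$, a positive definite weight matrix $W$ (in particular, any positive definite $W$ for which $K=EWE^{\mathsf T}$ has a prescribed eigendecomposition is allowed), and a measured angular velocity $\Omega^m\in\mathbb R^3$. Let $E=[e_1\ e_2\ e_1\times e_2]$ and $U^m=[u^m_1\ u^m_2\ u^m_1\times u^m_2]$ if $k=2$, and $E=[e_1\cdots e_k]$, $U^m=[u_1^m\cdots u_k^m]$ if $k>2$. Put $L=EW(U^m)^{\mathsf T}$, $S_L(\hat R)=\mathrm{vex}(L^{\mathsf T}\hat R-\hat R^{\mathsf T}L)$ and $\mathcal U^0(\hat R,U^m)=\tfrac12\langle E-\hat RU^m,(E-\hat RU^m)W\rangle$ with $\langle A,B\rangle=\mathrm{trace}(A^{\mathsf T}B)$. Let $\Phi$ be $C^2$ on $[0,\infty)$ with $\Phi(0)=0$ and $\Phi'>0$ on $[0,\infty)$,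 let $m>0$, and let $D\in\mathbb R^{3\times3}$ be positive definite. An index $i$ denotes data at the $i$-th sampling time; write $\mathcal U^0_i(\hat R)=\mathcal U^0(\hat R,U^m_i)$. The discrete-time filter with step $h>0$ is, with $\hat\Omega_i=\Omega^m_i-\omega_i$, $$\hat R_{i+1}=\hat R_i\exp(h\hat\Omega_i^\times),\qquad (1)$$ $$m\,\omega_{i+1}=\exp(-h\hat\Omega_{i+1}^\times)\Big\{(mI-hD)\,\omega_i+h\,\Phi'\big(\mathcal U^0_{i+1}(\hat R_{i+1})\big)S_{L_{i+1}}(\hat R_{i+1})\Big\}.\qquad (2)$$ **(a) Variational integrator on $SO(3)$.** Let $h>0$, $N\ge0$, $\hat R_0\in SO(3)$, let (1) hold for $0\le i\le N$, and let $\tau_{i+1}=D\omega_i$ for all $i\ge 0$. Then $\hat R_i\in SO(3)$ for $0\le i\le N+1$, and the following are equivalent: * the discrete Lagrange–d'Alembert principle holds on the indices $0,\dots,N+1$, i.e. $\delta\mathcal S_d+h\sum_{i=0}^{N}\tau_i^{\mathsf T}\Sigma_i=0$ for all admissible variations; * (2) holds for all $0\le i<N$. Here $\mathcal S_d=h\sum_{i=0}^{N+1}\big\{\tfrac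 m2(\Omega^m_i-\hat\Omega_i)^{\mathsf T}(\Omega^m_i-\hat\Omega_i)-\Phi(\mathcal U^0_i(\hat R_i))\big\}$, and $\delta\mathcal S_d$ is its derivative at $\varepsilon=0$ along $\hat R_i\exp(\varepsilon\Sigma_i^\times)$, $\hat\Omega_i+\varepsilon\,\delta\hat\Omega_i$. The admissible variations are the sequences $(\Sigma_i,\delta\hat\Omega_i)$ in $\mathbb R^3$ with $\Sigma_0=\Sigma_{N+1}=0$ and $\delta\hat\Omega_{N+1}=0$ that satisfy, with $\delta\hat R_i=\hat R_i\Sigma_i^\times$ and for $0\le i\le N$, the first variation of (1) in which, as a first-order approximation, $\hat\Omega_i^\times$ and $\delta\hat\Omega_i^\times$ are treated as commuting: $$\delta\hat R_{i+1}=\delta\hat R_i\exp(h\hat\Omega_i^\times)+h\hat R_i\exp(h\hat\Omega_i^\times)\,\delta\hat\Omega_i^\times .$$ **(b) Solvability and first-order accuracy.** Let $t_0<T$, let $e_j,u^m_j,W,\Omega^m$ be functions of time that are Lipschitz on $[t_0,T]$, and let $(\hat R,\omega)$ solve on $[t_0,T]$ the continuous-time filter $$\dot{\hat R}=\hat R\,\hat\Omega^\times,\qquad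 m\dot\omega=-m\,\hat\Omega\times\omega+\Phi'\big(\mathcal U^0(\hat R,U^m)\big)S_L(\hat R)-D\omega,\qquad \hat\Omega=\Omega^m-\omega,$$ with $\hat R(t_0)\in SO(3)$. Then there are constants $C$ and $h_0>0$, independent of $h$ and $N$, such that for all $0<h\le h_0$ and all $N\ge0$ with $t_0+Nh\le T$, the implicit scheme (1)–(2) for $0\le i<N$, with data sampled at $t_i=t_0+ih$ and started from $\hat R_0=\hat R(t_0)$, $\omega_0=\omega(t_0)$, has exactly one solution $(\hat R_i,\omega_i)_{0\le i\le N}$, and for all $0\le i\le N$ every entry of $\hat R_i-\hat R(t_i)$ and of $\omega_i-\omega(t_i)$ is at most $Ch$ in absolute value. -/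

import Mathlib

open scoped Matrix

noncomputable section

namespace AttitudeFilter

/-- Vectors of `ℝ³`. -/
abbrev Vec3 := Fin 3 → ℝ

/-- Real `3 × 3` matrices. -/
abbrev Mat3 := Matrix (Fin 3) (Fin 3) ℝ

/-- The rotation group `SO(3)`, as a set of matrices. -/
abbrev SO3 := Matrix.specialOrthogonalGroup (Fin 3) ℝ

/-- The cross-product matrix `x^×` of a vector `x`. -/
def hat (x : Vec3) : Mat3 :=
  !![0, -x 2, x 1; x 2, 0, -x 0; -x 1, x 0, 0]

/-- The inverse `vex : so(3) → ℝ³` of `x ↦ x^×` (only applied to skew-symmetric matrices). -/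
def vex (B : Mat3) : Vec3 := ![B 2 1, B 0 2, B 1 0]

theorem hat_mulVec (x y : Vec3) : hat x *ᵥ y = x ⨯₃ y := by
  ext i
  fin_cases i <;> simp [hat, Matrix.mulVec, dotProduct, Fin.sum_univ_three, cross_apply] <;> ring

theorem vex_hat (x : Vec3) : vex (hat x) = x := by
  ext i
  fin_cases i <;> simp [hat, vex]

theorem hat_vex (B : Mat3) (hB : Bᵀ = -B) : hat (vex B) = B := by
  have h : ∀ i j, B j i = -B i j := fun i j => congrFun (congrFun hB i) j
  ext i j
  have h00 := h 0 0
  have h11 := h 1 1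
  have h22 := h 2 2
  have h01 := h 0 1
  have h02 := h 0 2
  have h12 := h 1 2
  fin_cases i <;> fin_cases j <;> simp [hat, vex] <;> linarith

/-- The matrix whose columns are the given vectors `v 0, …, v (k-1)`; when `k = 2` the cross
product of the two vectors is appended as a third column. The number of columns is `max k 3`,
that is, `3` when `k = 2` and `k` when `k > 2`. -/
def vectorMatrix {k : ℕ} (hk : 2 ≤ k) (v : Fin k → Vec3) : Matrix (Fin 3) (Fin (max k 3)) ℝ :=
  Matrix.of fun r c =>
    if hc : (c : ℕ) < k then v ⟨c, hc⟩ r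
    else (v ⟨0, by omega⟩ ⨯₃ v ⟨1, by omega⟩) r

/-- What is available at one instant: `k ≥ 2` known inertial direction vectors `e`, their
body-frame measurements `u` (possibly noisy, hence unconstrained), the positive definite weight
matrix `W`, and the measured angular velocity `Ωm`. -/
structure Measurement (k : ℕ) where
  two_le : 2 ≤ k
  e : Fin k → Vec3
  u : Fin k → Vec3
  W : Matrix (Fin (max k 3)) (Fin (max k 3)) ℝ
  W_posDef : W.PosDef
  Ωm : Vec3

namespace Measurement

variable {k : ℕ}

/-- The matrix `E` of inertial vectors. -/
def E (M : Measurement k) : Matrix (Fin 3) (Fin (max k 3)) ℝ := vectorMatrix M.two_le M.e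

/-- The matrix `U^m` of measured body vectors. -/
def Um (M : Measurement k) : Matrix (Fin 3) (Fin (max k 3)) ℝ := vectorMatrix M.two_le M.u

/-- `L = E W (U^m)ᵀ`. -/
def L (M : Measurement k) : Mat3 := M.E * M.W * M.Umᵀ

/-- Wahba's cost `U⁰(R, U^m) = ½ ⟨E - R U^m, (E - R U^m) W⟩`, where `⟨A, B⟩ = trace (Aᵀ B)`. -/
def wahba (M : Measurement k) (R : Mat3) : ℝ :=
  (1 / 2) * ((M.E - R * M.Um)ᵀ * ((M.E - R * M.Um) * M.W)).trace

/-- `S_L(R) = vex (Lᵀ R - Rᵀ L)`. -/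
def S (M : Measurement k) (R : Mat3) : Vec3 := vex (M.Lᵀ * R - Rᵀ * M.L)

/-- `Φ'(U⁰(R, U^m)) S_L(R)`, with `Φ'` the derivative of `Φ` on `[0, ∞)`. -/
def innovation (M : Measurement k) (Φ : ℝ → ℝ) (R : Mat3) : Vec3 :=
  derivWithin Φ (Set.Ici 0) (M.wahba R) • M.S R

/-- All measured and known quantities are Lipschitz functions of time on `I`. -/
def LipschitzInTime (M : ℝ → Measurement k) (I : Set ℝ) : Prop :=
  ∃ K : NNReal,
    (∀ j, LipschitzOnWith K (fun t => (M t).e j) I) ∧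
    (∀ j, LipschitzOnWith K (fun t => (M t).u j) I) ∧
    (∀ a b, LipschitzOnWith K (fun t => (M t).W a b) I) ∧
    LipschitzOnWith K (fun t => (M t).Ωm) I

end Measurement

/-- The function `Φ : [0, ∞) → [0, ∞)` that reshapes Wahba's cost: it is `C²` with `Φ(0) = 0` and
`Φ' > 0` on `[0, ∞)`. Values of `Φ` at negative reals are never used. -/
structure IsCostShape (Φ : ℝ → ℝ) : Prop where
  contDiffOn : ContDiffOn ℝ 2 Φ (Set.Ici 0)
  map_zero : Φ 0 = 0
  deriv_pos : ∀ x, 0 ≤ x → 0 < derivWithin Φ (Set.Ici 0) x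

variable {k : ℕ}

/-! ### The continuous-time filter -/

/-- `(R, ω)` solves the continuous-time filter on `[t₀, T]`: with `Ω̂ = Ω^m - ω`,
`R' = R Ω̂^×` and `m ω' = -m Ω̂ × ω + Φ'(U⁰(R, U^m)) S_L(R) - D ω`, with `R(t₀) ∈ SO(3)`. -/
structure IsFilterSolution (Φ : ℝ → ℝ) (m : ℝ) (D : Mat3) (M : ℝ → Measurement k)
    (t₀ T : ℝ) (R : ℝ → Mat3) (ω : ℝ → Vec3) : Prop where
  init_mem : R t₀ ∈ SO3
  attitude : ∀ t ∈ Set.Icc t₀ T, ∀ a b,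
    HasDerivWithinAt (fun s => R s a b) ((R t * hat ((M t).Ωm - ω t)) a b) (Set.Icc t₀ T) t
  velocity : ∀ t ∈ Set.Icc t₀ T,
    HasDerivWithinAt (fun s => m • ω s)
      (-(m • (((M t).Ωm - ω t) ⨯₃ ω t)) + (M t).innovation Φ (R t) - D *ᵥ ω t)
      (Set.Icc t₀ T) t

/-! ### The discrete-time filter

Sequences are indexed by `ℕ`; on a horizon of `N` steps only the indices `0, …, N` matter. -/

/-- Discrete kinematics `R_{i+1} = R_i exp(h Ω̂_i^×)` for `0 ≤ i < N`. -/
def DiscreteKinematics (h : ℝ) (N : ℕ) (R : ℕ → Mat3) (Ωhat : ℕ → Vec3) : Prop :=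
  ∀ i < N, R (i + 1) = R i * NormedSpace.exp (h • hat (Ωhat i))

/-- The implicit velocity update from `i` to `i + 1`, with `Ω̂_{i+1} = Ω^m_{i+1} - ω_{i+1}`:
`m ω_{i+1} = exp(-h Ω̂_{i+1}^×) {(m I - h D) ω_i + h Φ'(U⁰_{i+1}) S_{L_{i+1}}(R_{i+1})}`. -/
def VelocityUpdate (Φ : ℝ → ℝ) (m : ℝ) (D : Mat3) (h : ℝ) (M : ℕ → Measurement k)
    (R : ℕ → Mat3) (ω : ℕ → Vec3) (i : ℕ) : Prop :=
  m • ω (i + 1) =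
    NormedSpace.exp (-h • hat ((M (i + 1)).Ωm - ω (i + 1))) *ᵥ
      ((m • (1 : Mat3) - h • D) *ᵥ ω i + h • (M (i + 1)).innovation Φ (R (i + 1)))

/-- `(R, ω)` is a run of `N` steps of the discrete-time filter with time step `h`. -/
structure IsDiscreteFilter (Φ : ℝ → ℝ) (m : ℝ) (D : Mat3) (h : ℝ) (M : ℕ → Measurement k)
    (N : ℕ) (R : ℕ → Mat3) (ω : ℕ → Vec3) : Prop where
  kinematics : DiscreteKinematics h N R (fun i => (M i).Ωm - ω i)
  velocity : ∀ i < N, VelocityUpdate Φ m D h M R ω i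

/-! ### The discrete Lagrange–d'Alembert principle -/

/-- The discrete action sum
`h ∑_{i=0}^N { (m/2) (Ω^m_i - Ω̂_i)ᵀ (Ω^m_i - Ω̂_i) - Φ(U⁰(R_i, U^m_i)) }`. -/
def actionSum (Φ : ℝ → ℝ) (m h : ℝ) (M : ℕ → Measurement k) (N : ℕ)
    (R : ℕ → Mat3) (Ωhat : ℕ → Vec3) : ℝ :=
  h * ∑ i ∈ Finset.range (N + 1),
    (m / 2 * (((M i).Ωm - Ωhat i) ⬝ᵥ ((M i).Ωm - Ωhat i)) - Φ ((M i).wahba (R i)))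

/-- Admissible variations `δR_i = R_i η_i^×`, `δΩ̂_i` of a discrete trajectory with fixed end
points. They satisfy the first variation of the discrete kinematics,
`δR_{i+1} = δR_i exp(h Ω̂_i^×) + R_i δ(exp(h Ω̂_i^×))`, in which, as a first-order approximation,
`Ω̂_i^×` and `δΩ̂_i^×` are treated as commuting: `δ(exp(h Ω̂_i^×)) = h exp(h Ω̂_i^×) δΩ̂_i^×`. -/
structure IsVariation (h : ℝ) (N : ℕ) (R : ℕ → Mat3) (Ωhat : ℕ → Vec3)
    (η δΩ : ℕ → Vec3) : Prop where
  left_fixed : η 0 = 0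
  right_fixed : η N = 0
  right_velocity_fixed : δΩ N = 0
  kinematics : ∀ i < N,
    R (i + 1) * hat (η (i + 1)) =
      R i * hat (η i) * NormedSpace.exp (h • hat (Ωhat i))
        + h • (R i * NormedSpace.exp (h • hat (Ωhat i)) * hat (δΩ i))

/-- The discrete Lagrange–d'Alembert principle with dissipation `τ` on a horizon of `N` steps:
`δS_d + h ∑_{i=0}^{N-1} τ_iᵀ η_i = 0` for every admissible variation, where `δS_d` is the
derivative of the action sum along the varied trajectory
`R_i exp(ε η_i^×)`, `Ω̂_i + ε δΩ̂_i` at `ε = 0`. -/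
def DiscreteLagrangeDAlembert (Φ : ℝ → ℝ) (m h : ℝ) (M : ℕ → Measurement k) (N : ℕ)
    (R : ℕ → Mat3) (Ωhat τ : ℕ → Vec3) : Prop :=
  ∀ η δΩ : ℕ → Vec3, IsVariation h N R Ωhat η δΩ →
    ∃ δS : ℝ,
      HasDerivAt (fun ε : ℝ => actionSum Φ m h M N
        (fun i => R i * NormedSpace.exp (ε • hat (η i))) (fun i => Ωhat i + ε • δΩ i)) δS 0 ∧
      δS + h * ∑ i ∈ Finset.range N, τ i ⬝ᵥ η i = 0

end AttitudeFilter

end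

open scoped Matrix

noncomputable section

namespace AttitudeFilter

/-! ### Cross-product matrices, rotations and the linearized kinematics -/

section Kinematics

/-! The variational half is a discrete integration by parts. Since `exp(h Ω̂^×)` is a rotation
`F_i`, the constraint on variations collapses to the vector recursion `η_{i+1} = F_iᵀ η_i + h δΩ_i`
(`linearized_kinematics_iff`): the interior `η_i` are free, and they determine the `δΩ_i`. On
`SO(3)` Wahba's cost is affine in the attitude, and its derivative in the direction `R η^×` is
`S_L(R) ⬝ᵥ η` (`hasDerivAt_wahba`). Eliminating `δΩ` (`first_variation_sum`) turns the first
variation plus the dissipation into a sum of pairings with the interior `η_{i+1}`. Each coefficient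
is the velocity update multiplied by the rotation `F_{i+1}` (`velocityUpdate_iff`), so the sum
vanishes for all variations exactly when every update holds.

The accuracy half is consistency plus stability. The decisive point is an a priori bound: a rotation
preserves Euclidean length, so taking lengths in the implicit equation removes the unknown
exponential and bounds every run on `[t₀, T]`, for every step size (`exists_length_bound`). The
attitudes stay in the bounded set `SO(3)`. On the resulting bounded region everything is Lipschitz,
and a single step threshold makes each implicit equation a contraction
(`exists_existsUnique_implicit`, `exists_wellPosed`). Both the exact flow and the scheme differ from
one Euler step by `O(h²)` (`exists_euler_error`, `exists_discrete_error`), and discrete Gronwall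
sums these defects to `O(h)` (`exists_global_error`). -/

theorem mem_SO3_iff {R : Mat3} : R ∈ SO3 ↔ Rᵀ * R = 1 ∧ R.det = 1 := by
  rw [Matrix.mem_specialOrthogonalGroup_iff, Matrix.mem_orthogonalGroup_iff']

theorem mul_transpose_of_mem_SO3 {R : Mat3} (hR : R ∈ SO3) : R * Rᵀ = 1 :=
  mul_eq_one_comm.mp (mem_SO3_iff.mp hR).1

theorem mul_mem_SO3 {R Q : Mat3} (hR : R ∈ SO3) (hQ : Q ∈ SO3) : R * Q ∈ SO3 :=
  mul_mem hR hQ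

theorem transpose_hat (x : Vec3) : (hat x)ᵀ = -hat x := by
  ext i j
  fin_cases i <;> fin_cases j <;> simp [hat]

theorem hat_injective : Function.Injective hat :=
  Function.LeftInverse.injective vex_hat

theorem hat_add (x y : Vec3) : hat (x + y) = hat x + hat y := by
  ext i j
  fin_cases i <;> fin_cases j <;> simp [hat] <;> ring

theorem hat_smul (c : ℝ) (x : Vec3) : hat (c • x) = c • hat x := by
  ext i j
  fin_cases i <;> fin_cases j <;> simp [hat]

theorem hat_sub (x y : Vec3) : hat (x - y) = hat x - hat y := by
  ext i j
  fin_cases i <;> fin_cases j <;> simp [hat] <;> ring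

/-- This is the matrix form of the multilinear identity `det [Ax, Ay, Az] = det A · det [x, y, z]`,
hence a polynomial identity that needs no invertibility. -/
theorem transpose_mul_hat_mulVec_mul (A : Mat3) (x : Vec3) :
    Aᵀ * hat (A *ᵥ x) * A = A.det • hat x := by
  ext i j
  fin_cases i <;> fin_cases j <;>
    simp [hat, Matrix.mul_apply, Matrix.mulVec, dotProduct, Fin.sum_univ_three,
      Matrix.det_fin_three] <;> ring

theorem hat_transpose_mulVec {F : Mat3} (hF : F ∈ SO3) (x : Vec3) :
    hat (Fᵀ *ᵥ x) = Fᵀ * hat x * F := by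
  have h := transpose_mul_hat_mulVec_mul Fᵀ x
  rw [Matrix.det_transpose, (mem_SO3_iff.mp hF).2, one_smul, Matrix.transpose_transpose] at h
  have h1 := (mem_SO3_iff.mp hF).1
  rw [← h]
  calc hat (Fᵀ *ᵥ x) = (Fᵀ * F) * hat (Fᵀ *ᵥ x) * (Fᵀ * F) := by rw [h1]; simp
    _ = _ := by simp only [Matrix.mul_assoc]

theorem transpose_exp_hat (x : Vec3) (h : ℝ) :
    (NormedSpace.exp (h • hat x))ᵀ = NormedSpace.exp (-h • hat x) := by
  rw [← Matrix.exp_transpose, Matrix.transpose_smul, transpose_hat, smul_neg, neg_smul]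

theorem exp_hat_mem_SO3 (x : Vec3) (h : ℝ) : NormedSpace.exp (h • hat x) ∈ SO3 := by
  have orth : ∀ c : ℝ,
      (NormedSpace.exp (c • hat x))ᵀ * NormedSpace.exp (c • hat x) = 1 := fun c => by
    rw [transpose_exp_hat, neg_smul,
      ← Matrix.exp_add_of_commute _ _ (Commute.neg_left (Commute.refl (c • hat x))),
      neg_add_cancel, NormedSpace.exp_zero]
  refine mem_SO3_iff.mpr ⟨orth h, ?_⟩
  -- Orthogonality alone leaves the determinant at `±1`. Writing the exponential as a square `G * G`
  -- gives `det G ^ 2 = det (Gᵀ * G) = 1`.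
  have hsq : NormedSpace.exp (h • hat x) =
      NormedSpace.exp ((h / 2) • hat x) * NormedSpace.exp ((h / 2) • hat x) := by
    rw [← Matrix.exp_add_of_commute _ _ (Commute.refl _), ← add_smul, add_halves]
  have := congrArg Matrix.det (orth (h / 2))
  rw [Matrix.det_mul, Matrix.det_transpose, Matrix.det_one] at this
  rw [hsq, Matrix.det_mul, this]

theorem DiscreteKinematics.mem_SO3 {h : ℝ} {N : ℕ} {R : ℕ → Mat3} {Ωhat : ℕ → Vec3}
    (hk : DiscreteKinematics h N R Ωhat) (h0 : R 0 ∈ SO3) : ∀ i ≤ N, R i ∈ SO3 := by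
  intro i
  induction i with
  | zero => exact fun _ => h0
  | succ i ih =>
    intro hi
    rw [hk i hi]
    exact mul_mem_SO3 (ih (by omega)) (exp_hat_mem_SO3 _ _)

theorem dotProduct_mulVec_of_mem_SO3 {F : Mat3} (hF : F ∈ SO3) (v : Vec3) :
    (F *ᵥ v) ⬝ᵥ (F *ᵥ v) = v ⬝ᵥ v := by
  rw [Matrix.dotProduct_mulVec, ← Matrix.mulVec_transpose, Matrix.mulVec_mulVec,
    (mem_SO3_iff.mp hF).1, Matrix.one_mulVec]

/-- On a discrete trajectory in `SO(3)` the linearized kinematics reads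
`η_{i+1} = exp(h Ω̂_i^×)ᵀ η_i + h δΩ̂_i`. -/
theorem linearized_kinematics_iff {h : ℝ} {R F : Mat3} {η η' δ : Vec3}
    (hR : R ∈ SO3) (hF : F ∈ SO3) :
    R * F * hat η' = R * hat η * F + h • (R * F * hat δ) ↔ η' = Fᵀ *ᵥ η + h • δ := by
  have hRF := (mem_SO3_iff.mp (mul_mem_SO3 hR hF)).1
  have hFt := mul_transpose_of_mem_SO3 hF
  have key : R * hat η * F + h • (R * F * hat δ) = R * F * hat (Fᵀ *ᵥ η + h • δ) := by
    rw [hat_add, hat_smul, hat_transpose_mulVec hF, Matrix.mul_add, Matrix.mul_smul]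
    congr 1
    calc R * hat η * F = R * (F * Fᵀ) * hat η * F := by rw [hFt, Matrix.mul_one]
      _ = _ := by simp only [Matrix.mul_assoc]
  rw [key]
  constructor
  · intro e
    apply hat_injective
    have := congrArg ((R * F)ᵀ * ·) e
    simpa only [← Matrix.mul_assoc, ← Matrix.transpose_mul, hRF, Matrix.one_mul,
      Matrix.mul_assoc (R * F)ᵀ] using this
  · rintro rfl
    rfl

end Kinematics

/-! ### Wahba's cost and its derivative along rotations -/

section Wahba

variable {k : ℕ}

/-- A skew matrix pairs only with the skew part of `A`; this is how `vex` enters the gradient. -/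
theorem trace_hat_mul (η : Vec3) (A : Mat3) :
    (hat η * A).trace = -(η ⬝ᵥ vex (A - Aᵀ)) := by
  simp [hat, vex, Matrix.trace, Matrix.vecMul, Fin.sum_univ_three, dotProduct]
  ring

namespace Measurement

theorem W_transpose (M : Measurement k) : M.Wᵀ = M.W := by
  simpa using M.W_posDef.isHermitian.eq

/-- Cyclicity of the trace gives `½ trace (V W Vᵀ)` with `V = E - R U^m`. The bound holds for every
matrix `R`, which keeps all arguments of `Φ` inside `[0, ∞)`. -/
theorem wahba_nonneg (M : Measurement k) (R : Mat3) : 0 ≤ M.wahba R := by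
  have h := (M.W_posDef.posSemidef.mul_mul_conjTranspose_same (M.E - R * M.Um)).trace_nonneg
  rw [Matrix.conjTranspose_eq_transpose_of_trivial, Matrix.mul_assoc, Matrix.trace_mul_comm,
    Matrix.mul_assoc, Matrix.trace_mul_comm] at h
  rw [wahba, ← Matrix.mul_assoc]
  positivity

/-- On `SO(3)`, Wahba's cost is affine. -/
theorem wahba_eq_of_mem_SO3 (M : Measurement k) {R : Mat3} (hR : R ∈ SO3) :
    M.wahba R = (1 / 2) * ((M.Eᵀ * M.E * M.W).trace + (M.Umᵀ * M.Um * M.W).trace)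
      - (Rᵀ * M.L).trace := by
  have h1 : (M.Eᵀ * (R * M.Um) * M.W).trace = (Rᵀ * M.L).trace := by
    rw [← Matrix.trace_transpose]
    simp only [Matrix.transpose_mul, Matrix.transpose_transpose, W_transpose, L]
    rw [Matrix.trace_mul_comm]
    simp only [Matrix.mul_assoc]
    rw [Matrix.trace_mul_comm]
    simp only [Matrix.mul_assoc]
  have h2 : ((R * M.Um)ᵀ * M.E * M.W).trace = (Rᵀ * M.L).trace := by
    simp only [Matrix.transpose_mul, L, Matrix.mul_assoc]
    rw [Matrix.trace_mul_comm]
    simp only [Matrix.mul_assoc]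
  have h3 : (R * M.Um)ᵀ * (R * M.Um) * M.W = M.Umᵀ * M.Um * M.W := by
    rw [Matrix.transpose_mul, Matrix.mul_assoc M.Umᵀ, ← Matrix.mul_assoc Rᵀ,
      (mem_SO3_iff.mp hR).1, Matrix.one_mul]
  unfold wahba
  rw [← Matrix.mul_assoc, Matrix.transpose_sub, Matrix.sub_mul, Matrix.mul_sub, Matrix.mul_sub,
    Matrix.sub_mul, Matrix.sub_mul, Matrix.sub_mul, h3]
  simp only [Matrix.trace_sub, h1, h2]
  ring

end Measurement

section Derivatives

attribute [local instance] Matrix.linftyOpNormedRing Matrix.linftyOpNormedAlgebra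

/-- Stated for entries, so that the norm chosen to differentiate the exponential does not appear in
the result. -/
theorem hasDerivAt_mul_exp_hat_apply (R : Mat3) (η : Vec3) (a b : Fin 3) :
    HasDerivAt (fun ε : ℝ => (R * NormedSpace.exp (ε • hat η)) a b) ((R * hat η) a b) 0 := by
  have h := (hasDerivAt_exp_smul_const (𝕂 := ℝ) (hat η) 0).const_mul R
  simp only [zero_smul, NormedSpace.exp_zero, one_mul] at h
  let f : Mat3 →L[ℝ] ℝ := LinearMap.toContinuousLinearMap (Matrix.entryLinearMap ℝ ℝ a b)
  exact f.hasFDerivAt.comp_hasDerivAt 0 h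

end Derivatives

theorem hasDerivAt_wahba (M : Measurement k) {R : Mat3} (hR : R ∈ SO3) (η : Vec3) :
    HasDerivAt (fun ε : ℝ => M.wahba (R * NormedSpace.exp (ε • hat η))) (M.S R ⬝ᵥ η) 0 := by
  have h1 : HasDerivAt
      (fun ε : ℝ => ((R * NormedSpace.exp (ε • hat η))ᵀ * M.L).trace)
      ((R * hat η)ᵀ * M.L).trace 0 := by
    simp only [Matrix.trace, Matrix.diag, Matrix.mul_apply (M := (_ : Mat3)ᵀ),
      Matrix.transpose_apply]
    exact HasDerivAt.fun_sum fun i _ => HasDerivAt.fun_sum fun j _ =>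
      (hasDerivAt_mul_exp_hat_apply R η j i).mul_const _
  have e : ((R * hat η)ᵀ * M.L).trace = -(M.S R ⬝ᵥ η) := by
    rw [Matrix.transpose_mul, transpose_hat, Matrix.neg_mul, Matrix.neg_mul, Matrix.trace_neg,
      Matrix.mul_assoc, trace_hat_mul, Measurement.S, dotProduct_comm (vex _)]
    simp [vex, Matrix.mul_apply, Fin.sum_univ_three, dotProduct]
    ring
  have h2 := h1.const_sub
    ((1 / 2) * ((M.Eᵀ * M.E * M.W).trace + (M.Umᵀ * M.Um * M.W).trace))
  rw [e, neg_neg] at h2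
  refine h2.congr_of_eventuallyEq (Filter.Eventually.of_forall fun ε => ?_)
  exact M.wahba_eq_of_mem_SO3 (mul_mem_SO3 hR (exp_hat_mem_SO3 η ε))

theorem hasDerivAt_shaped_wahba {Φ : ℝ → ℝ} (hΦ : IsCostShape Φ) (M : Measurement k) {R : Mat3}
    (hR : R ∈ SO3) (η : Vec3) :
    HasDerivAt (fun ε : ℝ => Φ (M.wahba (R * NormedSpace.exp (ε • hat η))))
      (M.innovation Φ R ⬝ᵥ η) 0 := by
  have hd : DifferentiableWithinAt ℝ Φ (Set.Ici 0) (M.wahba R) :=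
    hΦ.contDiffOn.differentiableOn (by norm_num) _ (M.wahba_nonneg R)
  have hw := (hasDerivAt_wahba M hR η).hasDerivWithinAt (s := Set.univ)
  have hd' := hd.hasDerivWithinAt
  have e : M.wahba R = M.wahba (R * NormedSpace.exp ((0 : ℝ) • hat η)) := by
    simp [NormedSpace.exp_zero]
  -- `Φ` is controlled only from the right at `0`. The chain rule within `[0, ∞)` suffices, because
  -- the cost never leaves that set.
  have h := HasDerivWithinAt.comp (h₂ := Φ) (s' := Set.Ici 0) (0 : ℝ)
    (h₂' := derivWithin Φ (Set.Ici 0) (M.wahba R)) (by rw [← e]; exact hd') hw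
    (fun ε _ => M.wahba_nonneg _)
  rw [hasDerivWithinAt_univ] at h
  simpa [Measurement.innovation, smul_dotProduct, Function.comp_def] using h

end Wahba

/-! ### The discrete Lagrange–d'Alembert principle -/

section LagrangeDAlembert

variable {k : ℕ}

theorem hasDerivAt_sub_dotProduct_self (a x d : Vec3) :
    HasDerivAt (fun ε : ℝ => (a - (x + ε • d)) ⬝ᵥ (a - (x + ε • d))) (-(2 * ((a - x) ⬝ᵥ d))) 0 := by
  have h : ∀ i, HasDerivAt (fun ε : ℝ => a i - (x i + ε * d i)) (-d i) 0 := fun i => by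
    simpa using (((hasDerivAt_id (0 : ℝ)).mul_const (d i)).const_add (x i)).const_sub (a i)
  have h2 := HasDerivAt.fun_sum (u := Finset.univ) fun i _ => (h i).mul (h i)
  convert! h2 using 1
  simp [dotProduct, Fin.sum_univ_three]
  ring

theorem hasDerivAt_actionSum {Φ : ℝ → ℝ} (hΦ : IsCostShape Φ) (m h : ℝ)
    (M : ℕ → Measurement k) (N : ℕ) {R : ℕ → Mat3} (hR : ∀ i ≤ N, R i ∈ SO3)
    (Ωhat η δΩ : ℕ → Vec3) :
    HasDerivAt (fun ε : ℝ => actionSum Φ m h M N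
        (fun i => R i * NormedSpace.exp (ε • hat (η i))) (fun i => Ωhat i + ε • δΩ i))
      (h * ∑ i ∈ Finset.range (N + 1), (-(m * (((M i).Ωm - Ωhat i) ⬝ᵥ δΩ i))
        - (M i).innovation Φ (R i) ⬝ᵥ η i)) 0 := by
  unfold actionSum
  refine (HasDerivAt.fun_sum fun i hi => ?_).const_mul h
  have h1 := (hasDerivAt_sub_dotProduct_self (M i).Ωm (Ωhat i) (δΩ i)).const_mul (m / 2)
  have h2 := hasDerivAt_shaped_wahba hΦ (M i) (hR i (by simpa [Nat.lt_succ_iff] using hi)) (η i)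
  convert! h1.sub h2 using 1
  ring

/-- Summation by parts in the discrete Lagrange–d'Alembert principle. -/
theorem first_variation_sum {m h : ℝ} {N : ℕ} {F : ℕ → Mat3} {ω τ g η δΩ : ℕ → Vec3}
    (h0 : η 0 = 0) (hN : η (N + 1) = 0) (hδ : δΩ (N + 1) = 0)
    (hk : ∀ i < N + 1, η (i + 1) = (F i)ᵀ *ᵥ η i + h • δΩ i) :
    h * ∑ i ∈ Finset.range (N + 1 + 1), (-(m * (ω i ⬝ᵥ δΩ i)) - g i ⬝ᵥ η i)
        + h * ∑ i ∈ Finset.range (N + 1), τ i ⬝ᵥ η i =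
      ∑ i ∈ Finset.range N,
        (m • F (i + 1) *ᵥ ω (i + 1) - m • ω i - h • g (i + 1) + h • τ (i + 1)) ⬝ᵥ η (i + 1) := by
  -- The linearized kinematics eliminates `δΩ`, and `F i` moves across the dot product as an
  -- adjoint; the boundary terms of the resulting sums vanish with `η 0` and `η (N + 1)`.
  have e1 : ∀ i ∈ Finset.range (N + 1),
      h * (ω i ⬝ᵥ δΩ i) = ω i ⬝ᵥ η (i + 1) - (F i *ᵥ ω i) ⬝ᵥ η i := fun i hi => by
    rw [hk i (by simpa using hi), dotProduct_add, Matrix.dotProduct_mulVec,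
      ← Matrix.mulVec_transpose, Matrix.transpose_transpose, dotProduct_smul, smul_eq_mul]
    ring
  have e2 : h * ∑ i ∈ Finset.range (N + 1), ω i ⬝ᵥ δΩ i =
      ∑ i ∈ Finset.range N, (ω i - F (i + 1) *ᵥ ω (i + 1)) ⬝ᵥ η (i + 1) := by
    rw [Finset.mul_sum, Finset.sum_congr rfl e1, Finset.sum_sub_distrib, Finset.sum_range_succ,
      Finset.sum_range_succ' (fun i => (F i *ᵥ ω i) ⬝ᵥ η i)]
    simp [hN, h0, sub_dotProduct]
  have e3 : ∀ f : ℕ → Vec3, ∑ i ∈ Finset.range (N + 1), f i ⬝ᵥ η i =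
      ∑ i ∈ Finset.range N, f (i + 1) ⬝ᵥ η (i + 1) := fun f => by
    rw [Finset.sum_range_succ']
    simp [h0]
  rw [Finset.sum_range_succ, hδ, hN, Finset.sum_sub_distrib, Finset.sum_neg_distrib,
    ← Finset.mul_sum, e3, e3]
  have : ∀ a b c : ℝ, h * (-(m * a) - b + (-(m * (ω (N + 1) ⬝ᵥ 0)) - g (N + 1) ⬝ᵥ 0)) + h * c =
      -m * (h * a) + h * (c - b) := fun a b c => by
    simp
    ring
  rw [this, e2, ← Finset.sum_sub_distrib, Finset.mul_sum, Finset.mul_sum, ← Finset.sum_add_distrib]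
  refine Finset.sum_congr rfl fun i _ => ?_
  simp only [sub_dotProduct, add_dotProduct, smul_dotProduct, smul_eq_mul]
  ring

theorem isVariation_iff {h : ℝ} {N : ℕ} {R : ℕ → Mat3} {Ωhat η δΩ : ℕ → Vec3}
    (hk : DiscreteKinematics h N R Ωhat) (h0 : R 0 ∈ SO3) :
    IsVariation h N R Ωhat η δΩ ↔ η 0 = 0 ∧ η N = 0 ∧ δΩ N = 0 ∧
      ∀ i < N, η (i + 1) = (NormedSpace.exp (h • hat (Ωhat i)))ᵀ *ᵥ η i + h • δΩ i := by
  have key : ∀ i < N, (R (i + 1) * hat (η (i + 1)) =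
      R i * hat (η i) * NormedSpace.exp (h • hat (Ωhat i))
        + h • (R i * NormedSpace.exp (h • hat (Ωhat i)) * hat (δΩ i)) ↔
      η (i + 1) = (NormedSpace.exp (h • hat (Ωhat i)))ᵀ *ᵥ η i + h • δΩ i) := fun i hi => by
    rw [hk i hi]
    exact linearized_kinematics_iff (hk.mem_SO3 h0 i hi.le) (exp_hat_mem_SO3 _ _)
  constructor
  · rintro ⟨a, b, c, d⟩
    exact ⟨a, b, c, fun i hi => (key i hi).mp (d i hi)⟩
  · rintro ⟨a, b, c, d⟩
    exact ⟨a, b, c, fun i hi => (key i hi).mpr (d i hi)⟩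

/-- Multiplying by the inverse rotation `exp(h Ω̂_{i+1}^×)` gives the form in which the update
appears as a coefficient of the first variation. -/
theorem velocityUpdate_iff {Φ : ℝ → ℝ} {m h : ℝ} {D : Mat3} {M : ℕ → Measurement k}
    {R : ℕ → Mat3} {ω : ℕ → Vec3} {i : ℕ} :
    VelocityUpdate Φ m D h M R ω i ↔
      m • NormedSpace.exp (h • hat ((M (i + 1)).Ωm - ω (i + 1))) *ᵥ ω (i + 1) - m • ω i
        - h • (M (i + 1)).innovation Φ (R (i + 1)) + h • D *ᵥ ω i = 0 := by
  have hF := exp_hat_mem_SO3 ((M (i + 1)).Ωm - ω (i + 1)) h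
  have e : ∀ y c : Vec3, y = NormedSpace.exp (-h • hat ((M (i + 1)).Ωm - ω (i + 1))) *ᵥ c ↔
      NormedSpace.exp (h • hat ((M (i + 1)).Ωm - ω (i + 1))) *ᵥ y - c = 0 := fun y c => by
    rw [← transpose_exp_hat, sub_eq_zero]
    constructor
    · rintro rfl
      rw [Matrix.mulVec_mulVec, mul_transpose_of_mem_SO3 hF, Matrix.one_mulVec]
    · rintro rfl
      rw [Matrix.mulVec_mulVec, (mem_SO3_iff.mp hF).1, Matrix.one_mulVec]
  rw [VelocityUpdate, e, Matrix.mulVec_smul, Matrix.sub_mulVec, Matrix.smul_mulVec,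
    Matrix.smul_mulVec, Matrix.one_mulVec]
  constructor <;> intro H <;> rw [← H] <;> abel

theorem discreteLagrangeDAlembert_iff {Φ : ℝ → ℝ} (hΦ : IsCostShape Φ) {m h : ℝ} (hh : 0 < h)
    {D : Mat3} {M : ℕ → Measurement k} {N : ℕ} {R : ℕ → Mat3} {Ωhat ω τ : ℕ → Vec3}
    (h0 : R 0 ∈ SO3) (hk : DiscreteKinematics h (N + 1) R Ωhat)
    (hω : ∀ i, ω i = (M i).Ωm - Ωhat i) (hτ : ∀ i, τ (i + 1) = D *ᵥ ω i) :
    DiscreteLagrangeDAlembert Φ m h M (N + 1) R Ωhat τ ↔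
      IsDiscreteFilter Φ m D h M N R ω := by
  have hΩ : ∀ i, (M i).Ωm - ω i = Ωhat i := fun i => by rw [hω, sub_sub_cancel]
  have hSO := hk.mem_SO3 h0
  set F : ℕ → Mat3 := fun i => NormedSpace.exp (h • hat (Ωhat i)) with hF
  set g : ℕ → Vec3 := fun i => (M i).innovation Φ (R i) with hg
  have hvel : ∀ i, VelocityUpdate Φ m D h M R ω i ↔
      m • F (i + 1) *ᵥ ω (i + 1) - m • ω i - h • g (i + 1) + h • τ (i + 1) = 0 := fun i => by
    rw [velocityUpdate_iff, hΩ, hτ]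
  have hvar : ∀ η δΩ, IsVariation h (N + 1) R Ωhat η δΩ → ∀ δS,
      HasDerivAt (fun ε : ℝ => actionSum Φ m h M (N + 1)
        (fun i => R i * NormedSpace.exp (ε • hat (η i))) (fun i => Ωhat i + ε • δΩ i)) δS 0 →
      δS + h * ∑ i ∈ Finset.range (N + 1), τ i ⬝ᵥ η i = ∑ i ∈ Finset.range N,
        (m • F (i + 1) *ᵥ ω (i + 1) - m • ω i - h • g (i + 1) + h • τ (i + 1)) ⬝ᵥ η (i + 1) := by
    intro η δΩ hv δS hδS
    obtain ⟨a, b, c, d⟩ := (isVariation_iff hk h0).mp hv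
    rw [hδS.unique (hasDerivAt_actionSum hΦ m h M (N + 1) hSO Ωhat η δΩ),
      ← first_variation_sum a b c d]
    simp only [hω, hg]
  constructor
  · intro H
    refine ⟨fun i hi => by simpa only [hΩ] using hk i (by omega), fun j hj => ?_⟩
    rw [hvel]
    refine dotProduct_eq_zero _ fun w => ?_
    -- The test variation is supported at the single interior index `j + 1`, with `δΩ` solved from
    -- the linearized kinematics by dividing by `h`. As `j < N`, both end points stay fixed.
    let η : ℕ → Vec3 := fun i => if i = j + 1 then w else 0
    let δΩ : ℕ → Vec3 := fun i => if i < N + 1 then h⁻¹ • (η (i + 1) - (F i)ᵀ *ᵥ η i) else 0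
    have hv : IsVariation h (N + 1) R Ωhat η δΩ := by
      refine (isVariation_iff hk h0).mpr ⟨by simp [η], ?_, by simp [δΩ], fun i hi => ?_⟩
      · simp only [η]
        rw [if_neg (by omega)]
      · simp only [δΩ, if_pos hi, smul_inv_smul₀ hh.ne', hF]
        abel
    obtain ⟨δS, h1, h2⟩ := H η δΩ hv
    rw [hvar η δΩ hv δS h1, Finset.sum_eq_single j] at h2
    · simpa [η] using h2
    · intro i _ hij
      simp [η, hij]
    · intro hj'
      simp [hj] at hj'
  · intro H η δΩ hv
    have h1 := hasDerivAt_actionSum hΦ m h M (N + 1) hSO Ωhat η δΩ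
    refine ⟨_, h1, ?_⟩
    rw [hvar η δΩ hv _ h1]
    refine Finset.sum_eq_zero fun i hi => ?_
    rw [(hvel i).mp (H.velocity i (by simpa using hi)), zero_dotProduct]

end LagrangeDAlembert

/-! ### A calculus of bounded Lipschitz functions -/

section BoundedLipschitz

variable {X : Type*} [PseudoMetricSpace X] {s : Set X}

/-- `f` is bounded and Lipschitz on `s`. -/
def BddLipschitzOn (s : Set X) (f : X → ℝ) : Prop :=
  ∃ C : ℝ, 0 ≤ C ∧ (∀ x ∈ s, |f x| ≤ C) ∧ ∀ x ∈ s, ∀ y ∈ s, |f x - f y| ≤ C * dist x y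

namespace BddLipschitzOn

variable {f g : X → ℝ}

theorem of_bounds {C K : ℝ} (h1 : ∀ x ∈ s, |f x| ≤ C)
    (h2 : ∀ x ∈ s, ∀ y ∈ s, |f x - f y| ≤ K * dist x y) : BddLipschitzOn s f := by
  refine ⟨max (max C K) 0, le_max_right _ _, fun x hx => (h1 x hx).trans (by simp), fun x hx y hy =>
    (h2 x hx y hy).trans ?_⟩
  gcongr
  simp

theorem const (c : ℝ) : BddLipschitzOn s (fun _ => c) :=
  of_bounds (C := |c|) (K := 0) (by simp) (by simp)

theorem add (hf : BddLipschitzOn s f) (hg : BddLipschitzOn s g) :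
    BddLipschitzOn s (fun x => f x + g x) := by
  obtain ⟨C, -, h1, h2⟩ := hf
  obtain ⟨K, -, h3, h4⟩ := hg
  refine of_bounds (C := C + K) (K := C + K)
    (fun x hx => (abs_add_le _ _).trans (add_le_add (h1 x hx) (h3 x hx))) fun x hx y hy => ?_
  calc |f x + g x - (f y + g y)| = |(f x - f y) + (g x - g y)| := by ring_nf
    _ ≤ |f x - f y| + |g x - g y| := abs_add_le _ _
    _ ≤ C * dist x y + K * dist x y := add_le_add (h2 x hx y hy) (h4 x hx y hy)
    _ = _ := by ring

/-- Boundedness is carried along with the Lipschitz property precisely so that products are allowed.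
-/
theorem mul (hf : BddLipschitzOn s f) (hg : BddLipschitzOn s g) :
    BddLipschitzOn s (fun x => f x * g x) := by
  obtain ⟨C, hC, h1, h2⟩ := hf
  obtain ⟨K, hK, h3, h4⟩ := hg
  refine of_bounds (C := C * K) (K := C * K + C * K) (fun x hx => ?_) fun x hx y hy => ?_
  · rw [abs_mul]
    exact mul_le_mul (h1 x hx) (h3 x hx) (abs_nonneg _) hC
  · calc |f x * g x - f y * g y| = |(f x - f y) * g x + f y * (g x - g y)| := by ring_nf
      _ ≤ |f x - f y| * |g x| + |f y| * |g x - g y| := by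
        rw [← abs_mul, ← abs_mul]
        exact abs_add_le _ _
      _ ≤ C * dist x y * K + C * (K * dist x y) := by
        gcongr
        exacts [h2 x hx y hy, h3 x hx, h1 y hy, h4 x hx y hy]
      _ = _ := by ring

theorem neg (hf : BddLipschitzOn s f) : BddLipschitzOn s (fun x => -f x) := by
  simpa using (const (-1)).mul hf

theorem sub (hf : BddLipschitzOn s f) (hg : BddLipschitzOn s g) :
    BddLipschitzOn s (fun x => f x - g x) := by
  simpa [sub_eq_add_neg] using hf.add hg.neg

theorem sum {ι : Type*} (t : Finset ι) {f : ι → X → ℝ} (h : ∀ i, BddLipschitzOn s (f i)) :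
    BddLipschitzOn s (fun x => ∑ i ∈ t, f i x) := by
  classical
  induction t using Finset.induction_on with
  | empty => simpa using const 0
  | insert i t hi ih => simpa [Finset.sum_insert hi] using (h i).add ih

theorem comp {Y : Type*} [PseudoMetricSpace Y] {t : Set Y} {φ : Y → X} (hf : BddLipschitzOn s f)
    (hφ : ∀ y ∈ t, φ y ∈ s) (hL : ∀ y ∈ t, ∀ z ∈ t, dist (φ y) (φ z) ≤ dist y z) :
    BddLipschitzOn t (fun y => f (φ y)) := by
  obtain ⟨C, hC, h1, h2⟩ := hf
  refine ⟨C, hC, fun y hy => h1 _ (hφ y hy), fun y hy z hz => ?_⟩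
  exact (h2 _ (hφ y hy) _ (hφ z hz)).trans (by gcongr; exact hL y hy z hz)

/-- The values of `f` lie in a compact interval `[0, C]`, on which a `C¹` function is Lipschitz. -/
theorem comp_contDiffOn (hf : BddLipschitzOn s f) (h0 : ∀ x ∈ s, 0 ≤ f x) {φ : ℝ → ℝ}
    (hφ : ContDiffOn ℝ 1 φ (Set.Ici 0)) : BddLipschitzOn s (fun x => φ (f x)) := by
  obtain ⟨C, hC, h1, h2⟩ := hf
  have hsub : Set.Icc 0 C ⊆ Set.Ici (0 : ℝ) := fun x hx => hx.1
  obtain ⟨K, hK⟩ := (hφ.mono hsub).exists_lipschitzOnWith one_ne_zero (convex_Icc 0 C) isCompact_Icc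
  obtain ⟨A, hA⟩ := isCompact_Icc.exists_bound_of_continuousOn (hφ.continuousOn.mono hsub)
  have hmem : ∀ x ∈ s, f x ∈ Set.Icc 0 C := fun x hx => ⟨h0 x hx, (le_abs_self _).trans (h1 x hx)⟩
  refine of_bounds (C := A) (K := K * C) (fun x hx => hA _ (hmem x hx)) fun x hx y hy => ?_
  have := hK.dist_le_mul _ (hmem x hx) _ (hmem y hy)
  rw [Real.dist_eq, Real.dist_eq] at this
  refine this.trans ?_
  rw [mul_assoc]
  gcongr
  exact h2 x hx y hy

theorem matrix_mul {l m n : Type*} [Fintype m] {A : X → Matrix l m ℝ} {B : X → Matrix m n ℝ}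
    (hA : ∀ i j, BddLipschitzOn s (fun x => A x i j))
    (hB : ∀ i j, BddLipschitzOn s (fun x => B x i j)) (i : l) (j : n) :
    BddLipschitzOn s (fun x => (A x * B x) i j) := by
  simp only [Matrix.mul_apply]
  exact sum _ fun r => (hA i r).mul (hB r j)

theorem mulVec {m n : Type*} [Fintype n] {A : X → Matrix m n ℝ} {v : X → n → ℝ}
    (hA : ∀ i j, BddLipschitzOn s (fun x => A x i j))
    (hv : ∀ j, BddLipschitzOn s (fun x => v x j)) (i : m) :
    BddLipschitzOn s (fun x => (A x *ᵥ v x) i) := by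
  simp only [Matrix.mulVec, dotProduct]
  exact sum _ fun r => (hA i r).mul (hv r)

theorem cross {v w : X → Vec3} (hv : ∀ j, BddLipschitzOn s (fun x => v x j))
    (hw : ∀ j, BddLipschitzOn s (fun x => w x j)) (j : Fin 3) :
    BddLipschitzOn s (fun x => (v x ⨯₃ w x) j) := by
  simp only [cross_apply]
  fin_cases j
  exacts [((hv 1).mul (hw 2)).sub ((hv 2).mul (hw 1)), ((hv 2).mul (hw 0)).sub ((hv 0).mul (hw 2)),
    ((hv 0).mul (hw 1)).sub ((hv 1).mul (hw 0))]

theorem hat {v : X → Vec3} (hv : ∀ j, BddLipschitzOn s (fun x => v x j)) (i j : Fin 3) :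
    BddLipschitzOn s (fun x => hat (v x) i j) := by
  fin_cases i <;> fin_cases j
  exacts [const 0, (hv 2).neg, hv 1, hv 2, const 0, (hv 0).neg, (hv 1).neg, hv 0, const 0]

theorem vectorMatrix {k : ℕ} (hk : 2 ≤ k) {v : X → Fin k → Vec3}
    (hv : ∀ c r, BddLipschitzOn s (fun x => v x c r)) (i : Fin 3) (j : Fin (max k 3)) :
    BddLipschitzOn s (fun x => vectorMatrix hk (v x) i j) := by
  by_cases hc : (j : ℕ) < k
  · simpa [AttitudeFilter.vectorMatrix, hc] using hv ⟨j, hc⟩ i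
  · simpa only [AttitudeFilter.vectorMatrix, Matrix.of_apply, dif_neg hc] using
      cross (hv ⟨0, by omega⟩) (hv ⟨1, by omega⟩) i

end BddLipschitzOn

theorem LipschitzOnWith.bddLipschitzOn_Icc {t₀ T : ℝ} {K : NNReal} {f : ℝ → ℝ}
    (h : LipschitzOnWith K f (Set.Icc t₀ T)) : BddLipschitzOn (Set.Icc t₀ T) f := by
  obtain ⟨A, hA⟩ := isCompact_Icc.exists_bound_of_continuousOn h.continuousOn
  exact .of_bounds hA fun x hx y hy => h.dist_le_mul x hx y hy

theorem LipschitzOnWith.bddLipschitzOn_Icc_apply {ι : Type*} [Fintype ι] {t₀ T : ℝ} {K : NNReal}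
    {f : ℝ → ι → ℝ} (h : LipschitzOnWith K f (Set.Icc t₀ T)) (i : ι) :
    BddLipschitzOn (Set.Icc t₀ T) (fun t => f t i) :=
  LipschitzOnWith.bddLipschitzOn_Icc (K := K) <| LipschitzOnWith.of_dist_le_mul fun x hx y hy =>
    (dist_le_pi_dist (f x) (f y) i).trans (h.dist_le_mul x hx y hy)

variable {k : ℕ} {M : X → Measurement k}

theorem bddLipschitzOn_innovation {Φ : ℝ → ℝ} (hΦ : IsCostShape Φ)
    (he : ∀ c r, BddLipschitzOn s (fun x => (M x).e c r))
    (hu : ∀ c r, BddLipschitzOn s (fun x => (M x).u c r))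
    (hW : ∀ i j, BddLipschitzOn s (fun x => (M x).W i j)) {R : X → Mat3}
    (hR : ∀ i j, BddLipschitzOn s (fun x => R x i j)) (i : Fin 3) :
    BddLipschitzOn s (fun x => (M x).innovation Φ (R x) i) := by
  -- A point is needed to extract `2 ≤ k`, which is a field of the measurement.
  rcases s.eq_empty_or_nonempty with rfl | ⟨x₀, -⟩
  · exact ⟨0, le_rfl, by simp, by simp⟩
  have hk := (M x₀).two_le
  have hE : ∀ i j, BddLipschitzOn s (fun x => (M x).E i j) :=
    BddLipschitzOn.vectorMatrix hk he
  have hU : ∀ i j, BddLipschitzOn s (fun x => (M x).Um i j) :=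
    BddLipschitzOn.vectorMatrix hk hu
  have hL : ∀ i j, BddLipschitzOn s (fun x => (M x).L i j) :=
    BddLipschitzOn.matrix_mul (BddLipschitzOn.matrix_mul hE hW) fun i j => hU j i
  have hS : ∀ i, BddLipschitzOn s (fun x => (M x).S (R x) i) := by
    have h : ∀ i j, BddLipschitzOn s
        (fun x => ((M x).Lᵀ * R x) i j - ((R x)ᵀ * (M x).L) i j) := fun i j =>
      (BddLipschitzOn.matrix_mul (fun i j => hL j i) hR i j).sub
        (BddLipschitzOn.matrix_mul (fun i j => hR j i) hL i j)
    intro i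
    fin_cases i
    exacts [h 2 1, h 0 2, h 1 0]
  have hV : ∀ i j, BddLipschitzOn s (fun x => ((M x).E - R x * (M x).Um) i j) := fun i j =>
    (hE i j).sub (BddLipschitzOn.matrix_mul hR hU i j)
  have hw : BddLipschitzOn s (fun x => (M x).wahba (R x)) :=
    (BddLipschitzOn.const _).mul <| BddLipschitzOn.sum _ fun i =>
      BddLipschitzOn.matrix_mul (fun i j => hV j i) (BddLipschitzOn.matrix_mul hV hW) i i
  have hd : ContDiffOn ℝ 1 (derivWithin Φ (Set.Ici 0)) (Set.Ici 0) :=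
    hΦ.contDiffOn.derivWithin (uniqueDiffOn_Ici 0) (by norm_num)
  exact (hw.comp_contDiffOn (fun x _ => (M x).wahba_nonneg _) hd).mul (hS i)

end BoundedLipschitz

/-! ### Bounds for the innovation and the filter vector field -/

section VectorField

attribute [local instance] Matrix.linftyOpNormedRing Matrix.linftyOpNormedAlgebra

theorem abs_apply_le_norm (A : Mat3) (i j : Fin 3) : |A i j| ≤ ‖A‖ := by
  rw [Matrix.linfty_opNorm_def]
  have h1 : ‖A i j‖₊ ≤ ∑ j, ‖A i j‖₊ :=
    Finset.single_le_sum (f := fun j => ‖A i j‖₊) (fun _ _ => zero_le) (Finset.mem_univ j)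
  have h2 : ∑ j, ‖A i j‖₊ ≤ Finset.univ.sup fun i => ∑ j, ‖A i j‖₊ :=
    Finset.le_sup (f := fun i => ∑ j, ‖A i j‖₊) (Finset.mem_univ i)
  exact_mod_cast h1.trans h2

theorem norm_le_of_abs_apply_le {A : Mat3} {c : ℝ} (hc : 0 ≤ c) (h : ∀ i j, |A i j| ≤ c) :
    ‖A‖ ≤ 3 * c := by
  lift c to NNReal using hc
  rw [Matrix.linfty_opNorm_def]
  have : (Finset.univ.sup fun i => ∑ j, ‖A i j‖₊) ≤ 3 * c := by
    refine Finset.sup_le fun i _ => (Finset.sum_le_card_nsmul _ _ c fun j _ => ?_).trans (by simp)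
    exact_mod_cast h i j
  exact_mod_cast this

theorem norm_hat_le (x : Vec3) : ‖hat x‖ ≤ 3 * ‖x‖ := by
  refine norm_le_of_abs_apply_le (norm_nonneg _) fun i j => ?_
  have h : ∀ i, |x i| ≤ ‖x‖ := fun i => norm_le_pi_norm x i
  fin_cases i <;> fin_cases j <;> simp [hat, h]

/-- The right-hand side of the continuous-time filter, as a vector field. -/
def filterField {k : ℕ} (Φ : ℝ → ℝ) (m : ℝ) (D : Mat3) (M : Measurement k) (x : Mat3 × Vec3) :
    Mat3 × Vec3 :=
  (x.1 * hat (M.Ωm - x.2),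
    m⁻¹ • (M.innovation Φ x.1 - D *ᵥ x.2) - hat (M.Ωm - x.2) *ᵥ x.2)

variable {k : ℕ} {M : ℝ → Measurement k} {t₀ T : ℝ}

theorem BddLipschitzOn.exists_norm_le_pi {X ι : Type*} [PseudoMetricSpace X] [Fintype ι]
    {s : Set X} {f : X → ι → ℝ} (h : ∀ i, BddLipschitzOn s (fun x => f x i)) :
    ∃ C : ℝ, 0 ≤ C ∧ (∀ x ∈ s, ‖f x‖ ≤ C) ∧ ∀ x ∈ s, ∀ y ∈ s, ‖f x - f y‖ ≤ C * dist x y := by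
  choose C hC h1 h2 using h
  have hle : ∀ i, C i ≤ ∑ i, C i := fun i =>
    Finset.single_le_sum (f := C) (fun i _ => hC i) (Finset.mem_univ i)
  have h0 : 0 ≤ ∑ i, C i := Finset.sum_nonneg fun i _ => hC i
  refine ⟨∑ i, C i, h0, fun x hx => ?_, fun x hx y hy => ?_⟩
  · exact (pi_norm_le_iff_of_nonneg h0).mpr fun i => (h1 i x hx).trans (hle i)
  · refine (pi_norm_le_iff_of_nonneg (mul_nonneg h0 dist_nonneg)).mpr fun i => ?_
    exact (h2 i x hx y hy).trans (by gcongr; exact hle i)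

theorem BddLipschitzOn.exists_norm_le_matrix {X : Type*} [PseudoMetricSpace X]
    {s : Set X} {f : X → Mat3} (h : ∀ i j, BddLipschitzOn s (fun x => f x i j)) :
    ∃ C : ℝ, 0 ≤ C ∧ (∀ x ∈ s, ‖f x‖ ≤ C) ∧ ∀ x ∈ s, ∀ y ∈ s, ‖f x - f y‖ ≤ C * dist x y := by
  obtain ⟨C, h0, h1, h2⟩ :=
    BddLipschitzOn.exists_norm_le_pi (f := fun x (p : Fin 3 × Fin 3) => f x p.1 p.2)
      fun p => h p.1 p.2
  refine ⟨3 * C, by positivity, fun x hx => ?_, fun x hx y hy => ?_⟩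
  · exact norm_le_of_abs_apply_le h0 fun i j =>
      (norm_le_pi_norm (fun p : Fin 3 × Fin 3 => f x p.1 p.2) (i, j)).trans (h1 x hx)
  · rw [mul_assoc]
    exact norm_le_of_abs_apply_le (by positivity) fun i j =>
      (norm_le_pi_norm ((fun p : Fin 3 × Fin 3 => f x p.1 p.2) -
        (fun p : Fin 3 × Fin 3 => f y p.1 p.2)) (i, j)).trans (h2 x hx y hy)

theorem Measurement.LipschitzInTime.bddLipschitzOn
    (hM : Measurement.LipschitzInTime M (Set.Icc t₀ T)) :
    (∀ c r, BddLipschitzOn (Set.Icc t₀ T) (fun t => (M t).e c r)) ∧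
    (∀ c r, BddLipschitzOn (Set.Icc t₀ T) (fun t => (M t).u c r)) ∧
    (∀ i j, BddLipschitzOn (Set.Icc t₀ T) (fun t => (M t).W i j)) ∧
    ∀ r, BddLipschitzOn (Set.Icc t₀ T) (fun t => (M t).Ωm r) := by
  obtain ⟨K, he, hu, hW, hΩ⟩ := hM
  exact ⟨fun c r => LipschitzOnWith.bddLipschitzOn_Icc_apply (he c) r,
    fun c r => LipschitzOnWith.bddLipschitzOn_Icc_apply (hu c) r,
    fun i j => LipschitzOnWith.bddLipschitzOn_Icc (hW i j),
    fun r => LipschitzOnWith.bddLipschitzOn_Icc_apply hΩ r⟩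

theorem exists_bound_innovation {Φ : ℝ → ℝ} (hΦ : IsCostShape Φ)
    (hM : Measurement.LipschitzInTime M (Set.Icc t₀ T)) (B : ℝ) :
    ∃ C : ℝ, 0 ≤ C ∧ (∀ t ∈ Set.Icc t₀ T, ∀ R : Mat3, ‖R‖ ≤ B → ‖(M t).innovation Φ R‖ ≤ C) ∧
      ∀ t ∈ Set.Icc t₀ T, ∀ s ∈ Set.Icc t₀ T, ∀ R Q : Mat3, ‖R‖ ≤ B → ‖Q‖ ≤ B →
        ‖(M t).innovation Φ R - (M s).innovation Φ Q‖ ≤ C * (|t - s| + ‖R - Q‖) := by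
  obtain ⟨he, hu, hW, -⟩ := hM.bddLipschitzOn
  -- Time and attitude form one variable, so a single Lipschitz constant covers both; the maximum
  -- distance on the product is bounded by the sum.
  let s : Set (ℝ × Mat3) := {p | p.1 ∈ Set.Icc t₀ T ∧ ‖p.2‖ ≤ B}
  have hc : ∀ {f : ℝ → ℝ}, BddLipschitzOn (Set.Icc t₀ T) f → BddLipschitzOn s fun p => f p.1 :=
    fun hf => hf.comp (fun p hp => hp.1) fun p _ q _ => le_max_left _ _
  have hR : ∀ i j, BddLipschitzOn s (fun p => p.2 i j) := fun i j =>
    .of_bounds (C := B) (K := 1) (fun p hp => (abs_apply_le_norm _ _ _).trans hp.2)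
      fun p _ q _ => by
        rw [one_mul]
        exact (abs_apply_le_norm (p.2 - q.2) i j).trans
          ((dist_eq_norm p.2 q.2).symm.le.trans (le_max_right _ _))
  obtain ⟨C, h0, h1, h2⟩ := BddLipschitzOn.exists_norm_le_pi <|
    bddLipschitzOn_innovation (M := fun p : ℝ × Mat3 => M p.1) hΦ (fun c r => hc (he c r))
      (fun c r => hc (hu c r)) (fun i j => hc (hW i j)) hR
  refine ⟨C, h0, fun t ht R hR => h1 (t, R) ⟨ht, hR⟩, fun t ht t' ht' R Q hR hQ =>
    (h2 (t, R) ⟨ht, hR⟩ (t', Q) ⟨ht', hQ⟩).trans ?_⟩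
  gcongr
  rw [Prod.dist_eq, Real.dist_eq, dist_eq_norm]
  exact max_le_add_of_nonneg (abs_nonneg _) (norm_nonneg _)

theorem exists_bound_filterField {Φ : ℝ → ℝ} (hΦ : IsCostShape Φ)
    (hM : Measurement.LipschitzInTime M (Set.Icc t₀ T)) (m : ℝ) (D : Mat3) (B : ℝ) :
    ∃ C : ℝ, 0 ≤ C ∧
      (∀ t ∈ Set.Icc t₀ T, ∀ x : Mat3 × Vec3, ‖x‖ ≤ B → ‖filterField Φ m D (M t) x‖ ≤ C) ∧
      ∀ t ∈ Set.Icc t₀ T, ∀ s ∈ Set.Icc t₀ T, ∀ x y : Mat3 × Vec3, ‖x‖ ≤ B → ‖y‖ ≤ B →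
        ‖filterField Φ m D (M t) x - filterField Φ m D (M s) y‖ ≤ C * (|t - s| + ‖x - y‖) := by
  obtain ⟨he, hu, hW, hΩ⟩ := hM.bddLipschitzOn
  let s : Set (ℝ × (Mat3 × Vec3)) := {p | p.1 ∈ Set.Icc t₀ T ∧ ‖p.2‖ ≤ B}
  have hc : ∀ {f : ℝ → ℝ}, BddLipschitzOn (Set.Icc t₀ T) f → BddLipschitzOn s fun p => f p.1 :=
    fun hf => hf.comp (fun p hp => hp.1) fun p _ q _ => le_max_left _ _
  have hR : ∀ i j, BddLipschitzOn s (fun p => p.2.1 i j) := fun i j =>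
    .of_bounds (C := B) (K := 1)
      (fun p hp => (abs_apply_le_norm _ _ _).trans ((le_max_left _ _).trans hp.2)) fun p _ q _ => by
        rw [one_mul]
        exact (abs_apply_le_norm (p.2.1 - q.2.1) i j).trans
          ((dist_eq_norm p.2.1 q.2.1).symm.le.trans
            ((le_max_left _ _).trans (le_max_right _ _)))
  have hω : ∀ i, BddLipschitzOn s (fun p => p.2.2 i) := fun i =>
    .of_bounds (C := B) (K := 1)
      (fun p hp => (norm_le_pi_norm p.2.2 i).trans ((le_max_right _ _).trans hp.2))
      fun p _ q _ => by
        rw [one_mul]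
        exact (norm_le_pi_norm (p.2.2 - q.2.2) i).trans
          ((dist_eq_norm p.2.2 q.2.2).symm.le.trans
            ((le_max_right _ _).trans (le_max_right _ _)))
  have hg := bddLipschitzOn_innovation (M := fun p : ℝ × (Mat3 × Vec3) => M p.1) hΦ
    (fun c r => hc (he c r)) (fun c r => hc (hu c r)) (fun i j => hc (hW i j)) hR
  have hh := BddLipschitzOn.hat (s := s) (v := fun p => (M p.1).Ωm - p.2.2)
    fun r => (hc (hΩ r)).sub (hω r)
  obtain ⟨C, h0, h1, h2⟩ := BddLipschitzOn.exists_norm_le_matrix <|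
    BddLipschitzOn.matrix_mul hR hh
  obtain ⟨C', h0', h1', h2'⟩ := BddLipschitzOn.exists_norm_le_pi (s := s)
    (f := fun p => (filterField Φ m D (M p.1) p.2).2) fun i =>
      ((BddLipschitzOn.const m⁻¹).mul ((hg i).sub
        (BddLipschitzOn.mulVec (fun i j => BddLipschitzOn.const (D i j)) hω i))).sub
        (BddLipschitzOn.mulVec hh hω i)
  refine ⟨max C C', le_max_of_le_left h0, fun t ht x hx => ?_, fun t ht t' ht' x y hx hy => ?_⟩
  · exact max_le_max (h1 (t, x) ⟨ht, hx⟩) (h1' (t, x) ⟨ht, hx⟩)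
  · have hd : dist (t, x) (t', y) ≤ |t - t'| + ‖x - y‖ := by
      rw [Prod.dist_eq, Real.dist_eq, dist_eq_norm]
      exact max_le_add_of_nonneg (abs_nonneg _) (norm_nonneg _)
    refine max_le ((h2 (t, x) ⟨ht, hx⟩ (t', y) ⟨ht', hy⟩).trans ?_)
      ((h2' (t, x) ⟨ht, hx⟩ (t', y) ⟨ht', hy⟩).trans ?_)
    · exact mul_le_mul (le_max_left _ _) hd dist_nonneg (le_max_of_le_left h0)
    · exact mul_le_mul (le_max_right _ _) hd dist_nonneg (le_max_of_le_left h0)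

end VectorField

/-! ### Exponential estimates and the implicit velocity equation -/

section ImplicitEquation

attribute [local instance] Matrix.linftyOpNormedRing Matrix.linftyOpNormedAlgebra

/-- Strict differentiability at `0` gives the Lipschitz bound, and truncating the power series after
`1 + A` gives the quadratic remainder. -/
theorem exists_exp_estimates : ∃ r C : ℝ, 0 < r ∧ 0 ≤ C ∧
    (∀ A B : Mat3, ‖A‖ ≤ r → ‖B‖ ≤ r →
      ‖NormedSpace.exp A - NormedSpace.exp B‖ ≤ C * ‖A - B‖) ∧
    ∀ A : Mat3, ‖A‖ ≤ r → ‖NormedSpace.exp A - 1 - A‖ ≤ C * ‖A‖ ^ 2 := by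
  obtain ⟨K, s, hs, hK⟩ := (hasStrictFDerivAt_exp_zero (𝕂 := ℝ) (𝔸 := Mat3)).exists_lipschitzOnWith
  have h2 := (NormedSpace.exp_hasFPowerSeriesAt_zero
    (𝕂 := ℝ) (𝔸 := Mat3)).isBigO_sub_partialSum_pow 2
  obtain ⟨c, hc0, hc⟩ := h2.exists_nonneg
  obtain ⟨r₁, hr₁, h₁⟩ := Metric.nhds_basis_closedBall.mem_iff.mp hs
  obtain ⟨r₂, hr₂, h₂⟩ := Metric.nhds_basis_closedBall.mem_iff.mp hc.bound
  refine ⟨min r₁ r₂, max K c, lt_min hr₁ hr₂, le_max_of_le_left K.2, fun A B hA hB => ?_,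
    fun A hA => ?_⟩
  · have hA' : A ∈ s := h₁ (by simpa using hA.trans (min_le_left _ _))
    have hB' : B ∈ s := h₁ (by simpa using hB.trans (min_le_left _ _))
    have := hK.dist_le_mul A hA' B hB'
    rw [dist_eq_norm, dist_eq_norm] at this
    exact this.trans (by gcongr; exact le_max_left _ _)
  · have h : A ∈ Metric.closedBall (0 : Mat3) r₂ := by simpa using hA.trans (min_le_right _ _)
    have h3 := h₂ h
    simp only [Set.mem_ofPred_eq, zero_add, FormalMultilinearSeries.partialSum,
      Finset.sum_range_succ, Finset.sum_range_zero, NormedSpace.expSeries_apply_eq,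
      Nat.factorial_zero, Nat.factorial_one, Nat.cast_one, inv_one, one_smul, pow_zero, pow_one,
      norm_pow, norm_norm] at h3
    rw [sub_sub]
    exact h3.trans (by gcongr; exact le_max_right _ _)

/-- The Euclidean length of a vector. -/
def length (v : Vec3) : ℝ := ‖WithLp.toLp 2 v‖

theorem length_nonneg (v : Vec3) : 0 ≤ length v := norm_nonneg _

theorem length_add_le (v w : Vec3) : length (v + w) ≤ length v + length w := norm_add_le _ _

theorem length_smul (c : ℝ) (v : Vec3) : length (c • v) = |c| * length v := by
  rw [length, WithLp.toLp_smul, norm_smul, Real.norm_eq_abs, length]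

theorem length_eq_sqrt (v : Vec3) : length v = √(v ⬝ᵥ v) := by
  simp [length, EuclideanSpace.norm_eq, dotProduct, sq]

theorem norm_le_length (v : Vec3) : ‖v‖ ≤ length v :=
  (pi_norm_le_iff_of_nonneg (length_nonneg v)).mpr fun i =>
    PiLp.norm_apply_le (WithLp.toLp 2 v) i

theorem length_le_norm (v : Vec3) : length v ≤ 2 * ‖v‖ := by
  rw [length_eq_sqrt]
  refine Real.sqrt_le_iff.mpr ⟨by positivity, ?_⟩
  have h : ∀ i, v i * v i ≤ ‖v‖ ^ 2 := fun i => by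
    have := norm_le_pi_norm v i
    rw [← sq, ← sq_abs, ← Real.norm_eq_abs]
    exact pow_le_pow_left₀ (norm_nonneg _) this 2
  rw [dotProduct, Fin.sum_univ_three]
  nlinarith [h 0, h 1, h 2, sq_nonneg ‖v‖]

/-- The supremum norm on `Vec3` is not rotation invariant; stability is therefore measured in
Euclidean length, and norms are compared only up to a constant. -/
theorem length_mulVec_of_mem_SO3 {F : Mat3} (hF : F ∈ SO3) (v : Vec3) :
    length (F *ᵥ v) = length v := by
  rw [length_eq_sqrt, length_eq_sqrt, dotProduct_mulVec_of_mem_SO3 hF]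

theorem length_mulVec_le (A : Mat3) (v : Vec3) : length (A *ᵥ v) ≤ 2 * ‖A‖ * length v :=
  calc length (A *ᵥ v) ≤ 2 * ‖A *ᵥ v‖ := length_le_norm _
    _ ≤ 2 * (‖A‖ * ‖v‖) := by gcongr; exact Matrix.linfty_opNorm_mulVec A v
    _ ≤ 2 * (‖A‖ * length v) := by gcongr; exact norm_le_length v
    _ = _ := by ring

theorem norm_le_of_mem_SO3 {R : Mat3} (hR : R ∈ SO3) : ‖R‖ ≤ 3 := by
  have h := norm_le_of_abs_apply_le (A := R) zero_le_one fun i j => ?_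
  · simpa using h
  have h1 : (Rᵀ * R) j j = 1 := by rw [(mem_SO3_iff.mp hR).1, Matrix.one_apply_eq]
  rw [Matrix.mul_apply] at h1
  have h2 : Rᵀ j i * R i j ≤ 1 := by
    rw [← h1]
    exact Finset.single_le_sum (f := fun i => Rᵀ j i * R i j)
      (fun i _ => mul_self_nonneg _) (Finset.mem_univ i)
  exact abs_le_one_iff_mul_self_le_one.mpr h2

/-- The implicit equation of the velocity update has exactly one solution when the step is small,
uniformly for bounded data. -/
theorem exists_existsUnique_implicit {m : ℝ} (hm : 0 < m) {A ρ : ℝ} (hA : 0 ≤ A) (hρ : 0 ≤ ρ) :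
    ∃ h₀ : ℝ, 0 < h₀ ∧ ∀ h : ℝ, 0 < h → h ≤ h₀ → ∀ a v : Vec3, ‖a‖ ≤ A → length v ≤ ρ →
      ∃! y : Vec3, m • y = NormedSpace.exp (-h • hat (a - y)) *ᵥ v := by
  obtain ⟨r, C, hr, hC, hLip, -⟩ := exists_exp_estimates
  -- The first term keeps the exponents within radius `r` for `y` in the ball of radius `m⁻¹ * ρ`;
  -- the second makes the contraction factor at most `1/2`. Each `+ 1` keeps a denominator positive.
  refine ⟨min (r / (3 * (A + m⁻¹ * ρ) + 1)) (1 / (6 * m⁻¹ * C * ρ + 1)), by positivity,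
    fun h hh hle a v ha hv => ?_⟩
  have hh1 : h * (3 * (A + m⁻¹ * ρ)) ≤ r := by
    have := (le_div_iff₀ (by positivity)).mp (hle.trans (min_le_left _ _))
    nlinarith
  have hh2 : h * (6 * m⁻¹ * C * ρ) ≤ 1 := by
    have := (le_div_iff₀ (by positivity)).mp (hle.trans (min_le_right _ _))
    nlinarith
  set f : Vec3 → Vec3 := fun y => m⁻¹ • NormedSpace.exp (-h • hat (a - y)) *ᵥ v with hf
  set s : Set Vec3 := Metric.closedBall 0 (m⁻¹ * ρ) with hs
  -- This holds for all `y`, not only for those in the ball: every fixed point lies in `s`, so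
  -- uniqueness is global.
  have hmaps : ∀ y, f y ∈ s := fun y => by
    rw [hs, mem_closedBall_zero_iff, hf, norm_smul, Real.norm_of_nonneg (by positivity)]
    gcongr
    exact (norm_le_length _).trans
      ((length_mulVec_of_mem_SO3 (exp_hat_mem_SO3 _ _) v).le.trans hv)
  have hsmall : ∀ y ∈ s, ‖-h • hat (a - y)‖ ≤ r := fun y hy => by
    rw [hs, mem_closedBall_zero_iff] at hy
    rw [norm_smul, norm_neg, Real.norm_of_nonneg hh.le]
    refine le_trans ?_ hh1
    gcongr
    refine (norm_hat_le _).trans ?_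
    gcongr
    exact (norm_sub_le _ _).trans (add_le_add ha hy)
  have hcontr : ∀ y ∈ s, ∀ z ∈ s, ‖f y - f z‖ ≤ 1 / 2 * ‖y - z‖ := fun y hy z hz => by
    have e : -h • hat (a - y) - -h • hat (a - z) = h • hat (y - z) := by
      rw [← smul_sub, ← hat_sub, sub_sub_sub_cancel_left, neg_smul, ← smul_neg, ← neg_one_smul ℝ,
        ← hat_smul, neg_one_smul, neg_sub]
    have h1 := hLip _ _ (hsmall y hy) (hsmall z hz)
    rw [e, norm_smul, Real.norm_of_nonneg hh.le] at h1
    calc ‖f y - f z‖ = m⁻¹ * ‖(NormedSpace.exp (-h • hat (a - y))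
          - NormedSpace.exp (-h • hat (a - z))) *ᵥ v‖ := by
          rw [hf, ← smul_sub, ← Matrix.sub_mulVec, norm_smul, Real.norm_of_nonneg (by positivity)]
      _ ≤ m⁻¹ * ((C * (h * (3 * ‖y - z‖))) * ρ) := by
          gcongr
          refine (Matrix.linfty_opNorm_mulVec _ _).trans ?_
          gcongr
          · exact h1.trans (by gcongr; exact norm_hat_le _)
          · exact (norm_le_length v).trans hv
      _ = h * (6 * m⁻¹ * C * ρ) * (1 / 2 * ‖y - z‖) := by ring
      _ ≤ 1 * (1 / 2 * ‖y - z‖) := by gcongr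
      _ = _ := one_mul _
  have hfix : ∀ y, m • y = NormedSpace.exp (-h • hat (a - y)) *ᵥ v ↔ f y = y := fun y =>
    ⟨fun e => by rw [hf]; simp only; rw [← e, inv_smul_smul₀ hm.ne'],
      fun e => by nth_rw 1 [← e]; rw [hf]; simp only; rw [smul_inv_smul₀ hm.ne']⟩
  have hms : Set.MapsTo f s s := fun y _ => hmaps y
  have hcw : ContractingWith (1 / 2) (hms.restrict f s s) := by
    refine ⟨by norm_num, LipschitzWith.of_dist_le_mul fun y z => ?_⟩
    simpa [Subtype.dist_eq, dist_eq_norm] using hcontr y y.2 z z.2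
  obtain ⟨y, hy, hyf, -⟩ := hcw.exists_fixedPoint' Metric.isClosed_closedBall.isComplete _
    (hmaps 0) (edist_ne_top _ _)
  refine ⟨y, (hfix y).mpr hyf, fun z hz => ?_⟩
  have hzf := (hfix z).mp hz
  have hz' : z ∈ s := hzf ▸ hmaps z
  have := hcontr z hz' y hy
  rw [hzf, hyf.eq] at this
  exact sub_eq_zero.mp (norm_le_zero_iff.mp (by linarith))

end ImplicitEquation

/-! ### A priori bounds and unique solvability -/

section Solvability

attribute [local instance] Matrix.linftyOpNormedRing Matrix.linftyOpNormedAlgebra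

/-- Discrete Gronwall inequality, from `1 + c ≤ exp c`. -/
theorem le_of_le_one_add_mul_add {u : ℕ → ℝ} {b c : ℝ} (hb : 0 ≤ b) (hc : 0 ≤ c) (h0 : 0 ≤ u 0)
    {N : ℕ} (hu : ∀ i < N, u (i + 1) ≤ (1 + c) * u i + b) :
    ∀ i ≤ N, u i ≤ (u 0 + i * b) * Real.exp (i * c) := by
  intro i
  induction i with
  | zero => simp
  | succ i ih =>
    intro hi
    have h1 : 1 + c ≤ Real.exp c := by linarith [Real.add_one_le_exp c]
    have h2 : 1 ≤ Real.exp ((i + 1 : ℕ) * c) := Real.one_le_exp (by positivity)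
    have h3 : Real.exp ((i + 1 : ℕ) * c) = Real.exp c * Real.exp (i * c) := by
      rw [← Real.exp_add]
      push_cast
      ring_nf
    calc u (i + 1) ≤ (1 + c) * u i + b := hu i (by omega)
      _ ≤ (1 + c) * ((u 0 + i * b) * Real.exp (i * c)) + b := by
        gcongr
        exact ih (by omega)
      _ ≤ Real.exp c * ((u 0 + i * b) * Real.exp (i * c)) + b * Real.exp ((i + 1 : ℕ) * c) := by
        gcongr
        exact le_mul_of_one_le_right hb h2
      _ = _ := by
        rw [h3]
        push_cast
        ring

theorem grid_mem_Icc {t₀ T h : ℝ} (hh : 0 < h) {N : ℕ} (hN : t₀ + N * h ≤ T) {i : ℕ} (hi : i ≤ N) :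
    t₀ + i * h ∈ Set.Icc t₀ T := by
  refine ⟨le_add_of_nonneg_right (by positivity), le_trans ?_ hN⟩
  gcongr

theorem grid_succ (t₀ h : ℝ) (i : ℕ) : t₀ + (i + 1 : ℕ) * h = t₀ + i * h + h := by
  push_cast
  ring

variable {k : ℕ} {Φ : ℝ → ℝ} {m : ℝ} {D : Mat3} {M : ℝ → Measurement k} {t₀ T : ℝ}

theorem length_forcing_le (hm : 0 < m) {h : ℝ} (hh : 0 < h) (ω g : Vec3) :
    length ((m • (1 : Mat3) - h • D) *ᵥ ω + h • g) ≤
      (m + h * (2 * ‖D‖)) * length ω + h * (2 * ‖g‖) := by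
  have e : (m • (1 : Mat3) - h • D) *ᵥ ω + h • g = m • ω + h • ((-D) *ᵥ ω + g) := by
    rw [Matrix.sub_mulVec, Matrix.smul_mulVec, Matrix.smul_mulVec, Matrix.one_mulVec,
      Matrix.neg_mulVec, smul_add, smul_neg]
    abel
  rw [e]
  calc _ ≤ length (m • ω) + length (h • ((-D) *ᵥ ω + g)) := length_add_le _ _
    _ = m * length ω + h * length ((-D) *ᵥ ω + g) := by
      rw [length_smul, length_smul, abs_of_pos hm, abs_of_pos hh]
    _ ≤ m * length ω + h * (2 * ‖D‖ * length ω + 2 * ‖g‖) := by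
      gcongr
      refine (length_add_le _ _).trans (add_le_add ?_ (length_le_norm g))
      simpa using length_mulVec_le (-D) ω
    _ = _ := by ring

/-- The rotation in the implicit update drops out on taking lengths, leaving an explicit linear
recursion for Gronwall. The bound applies to any run, before existence or uniqueness is known. -/
theorem exists_length_bound (hΦ : IsCostShape Φ) (hm : 0 < m) (D : Mat3)
    (hM : Measurement.LipschitzInTime M (Set.Icc t₀ T)) (w : Vec3) (hT : t₀ < T) :
    ∃ B : ℝ, 0 ≤ B ∧ ∀ h : ℝ, 0 < h → ∀ N : ℕ, t₀ + N * h ≤ T →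
      ∀ (Rd : ℕ → Mat3) (ωd : ℕ → Vec3), Rd 0 ∈ SO3 → ωd 0 = w →
        IsDiscreteFilter Φ m D h (fun i => M (t₀ + i * h)) N Rd ωd →
        ∀ i ≤ N, length (ωd i) ≤ B := by
  obtain ⟨G, hG0, hG, -⟩ := exists_bound_innovation hΦ hM 3
  have hτ : 0 ≤ T - t₀ := (sub_pos.mpr hT).le
  have hw := length_nonneg w
  refine ⟨(length w + (T - t₀) * (m⁻¹ * (2 * G))) *
    Real.exp ((T - t₀) * (m⁻¹ * (2 * ‖D‖))), by positivity,
    fun h hh N hN Rd ωd hR0 hω0 H i hi => ?_⟩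
  have hSO := H.kinematics.mem_SO3 hR0
  have step : ∀ i < N, length (ωd (i + 1)) ≤
      (1 + h * (m⁻¹ * (2 * ‖D‖))) * length (ωd i) + h * (m⁻¹ * (2 * G)) := fun i hi => by
    have h1 := congrArg length (H.velocity i hi)
    rw [length_smul, abs_of_pos hm, length_mulVec_of_mem_SO3 (exp_hat_mem_SO3 _ _)] at h1
    have h2 := hG _ (grid_mem_Icc hh hN (Nat.succ_le_of_lt hi)) _
      (norm_le_of_mem_SO3 (hSO _ (Nat.succ_le_of_lt hi)))
    have h3 := h1.le.trans (length_forcing_le hm hh _ _)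
    have h4 : length (ωd (i + 1)) = m⁻¹ * (m * length (ωd (i + 1))) :=
      (inv_mul_cancel_left₀ hm.ne' _).symm
    rw [h4]
    calc _ ≤ m⁻¹ * ((m + h * (2 * ‖D‖)) * length (ωd i) + h * (2 * G)) := by
          gcongr
          refine h3.trans ?_
          gcongr
      _ = _ := by
        field_simp
  have h1 := le_of_le_one_add_mul_add (u := fun i => length (ωd i)) (b := h * (m⁻¹ * (2 * G)))
    (c := h * (m⁻¹ * (2 * ‖D‖))) (by positivity) (by positivity) (length_nonneg _) step i hi
  beta_reduce at h1
  have hi' : i * h ≤ T - t₀ := by linarith [(grid_mem_Icc hh hN hi).2]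
  rw [hω0, ← mul_assoc, ← mul_assoc (i : ℝ)] at h1
  exact h1.trans (by gcongr)

theorem exists_existsUnique_velocityUpdate (hΦ : IsCostShape Φ) (hm : 0 < m) (D : Mat3)
    (hM : Measurement.LipschitzInTime M (Set.Icc t₀ T)) {B : ℝ} (hB : 0 ≤ B) :
    ∃ h₀ : ℝ, 0 < h₀ ∧ ∀ h : ℝ, 0 < h → h ≤ h₀ → ∀ t ∈ Set.Icc t₀ T, ∀ R ∈ SO3, ∀ ω : Vec3,
      length ω ≤ B → ∃! y : Vec3, m • y = NormedSpace.exp (-h • hat ((M t).Ωm - y)) *ᵥ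
        ((m • (1 : Mat3) - h • D) *ᵥ ω + h • (M t).innovation Φ R) := by
  obtain ⟨G, hG0, hG, -⟩ := exists_bound_innovation hΦ hM 3
  obtain ⟨A, hA0, hA, -⟩ := BddLipschitzOn.exists_norm_le_pi hM.bddLipschitzOn.2.2.2
  -- `ρ` is the forcing bound evaluated at `h = 1`, which is why the threshold is also capped at
  -- `1`.
  obtain ⟨h₀, hh₀, H⟩ := exists_existsUnique_implicit hm hA0
    (ρ := (m + 1 * (2 * ‖D‖)) * B + 1 * (2 * G)) (by positivity)
  refine ⟨min h₀ 1, by positivity, fun h hh hle t ht R hR ω hω => ?_⟩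
  refine H h hh (hle.trans (min_le_left _ _)) _ _ (hA t ht) ?_
  refine (length_forcing_le hm hh _ _).trans ?_
  have h1 : h ≤ 1 := hle.trans (min_le_right _ _)
  have h2 := hG t ht R (norm_le_of_mem_SO3 hR)
  have h3 := length_nonneg ω
  gcongr

/-- The run of the discrete filter obtained by solving the implicit equation at each step. -/
def discreteRun (Φ : ℝ → ℝ) (m : ℝ) (D : Mat3) (h : ℝ) (M : ℕ → Measurement k) (R₀ : Mat3)
    (ω₀ : Vec3) : ℕ → Mat3 × Vec3
  | 0 => (R₀, ω₀)
  | i + 1 =>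
    let x := discreteRun Φ m D h M R₀ ω₀ i
    let R := x.1 * NormedSpace.exp (h • hat ((M i).Ωm - x.2))
    (R, Classical.epsilon fun y => m • y = NormedSpace.exp (-h • hat ((M (i + 1)).Ωm - y)) *ᵥ
      ((m • (1 : Mat3) - h • D) *ᵥ x.2 + h • (M (i + 1)).innovation Φ R))

theorem exists_wellPosed (hΦ : IsCostShape Φ) (hm : 0 < m) (D : Mat3)
    (hM : Measurement.LipschitzInTime M (Set.Icc t₀ T)) {R₀ : Mat3} (hR₀ : R₀ ∈ SO3) (w : Vec3)
    (hT : t₀ < T) :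
    ∃ h₀ : ℝ, 0 < h₀ ∧ ∀ h : ℝ, 0 < h → h ≤ h₀ → ∀ N : ℕ, t₀ + N * h ≤ T →
      (∃ (Rd : ℕ → Mat3) (ωd : ℕ → Vec3), Rd 0 = R₀ ∧ ωd 0 = w ∧
        IsDiscreteFilter Φ m D h (fun i => M (t₀ + i * h)) N Rd ωd) ∧
      ∀ (Rd Rd' : ℕ → Mat3) (ωd ωd' : ℕ → Vec3),
        Rd 0 = R₀ → ωd 0 = w → Rd' 0 = R₀ → ωd' 0 = w →
        IsDiscreteFilter Φ m D h (fun i => M (t₀ + i * h)) N Rd ωd →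
        IsDiscreteFilter Φ m D h (fun i => M (t₀ + i * h)) N Rd' ωd' →
        ∀ i ≤ N, Rd i = Rd' i ∧ ωd i = ωd' i := by
  obtain ⟨B, hB0, hB⟩ := exists_length_bound hΦ hm D hM w hT
  obtain ⟨h₀, hh₀, hu⟩ := exists_existsUnique_velocityUpdate hΦ hm D hM hB0
  refine ⟨h₀, hh₀, fun h hh hle N hN => ⟨?_, ?_⟩⟩
  · let x := discreteRun Φ m D h (fun i => M (t₀ + i * h)) R₀ w
    have hk : ∀ n, DiscreteKinematics h n (fun i => (x i).1)
        (fun i => (M (t₀ + i * h)).Ωm - (x i).2) := fun n i _ => rfl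
    have key : ∀ n ≤ N, IsDiscreteFilter Φ m D h (fun i => M (t₀ + i * h)) n
        (fun i => (x i).1) (fun i => (x i).2) := by
      -- The a priori bound for the first `n` steps makes the next implicit equation solvable. As
      -- `B` does not depend on `n`, the threshold `h₀` never shrinks.
      intro n
      induction n with
      | zero => exact fun _ => ⟨hk 0, fun i hi => absurd hi (Nat.not_lt_zero i)⟩
      | succ n ih =>
        intro hn
        have hprev := ih (by omega)
        refine ⟨hk _, fun i hi => ?_⟩
        rcases Nat.lt_succ_iff_lt_or_eq.mp hi with hlt | rfl
        · exact hprev.velocity i hlt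
        · have hlen := hB h hh i ((grid_mem_Icc hh hN (by omega : i ≤ N)).2) _ _ hR₀ rfl hprev
            i le_rfl
          have hSO := (hk (i + 1)).mem_SO3 hR₀ (i + 1) le_rfl
          exact Classical.epsilon_spec
            (hu h hh hle _ (grid_mem_Icc hh hN hn) _ hSO _ hlen).exists
    exact ⟨fun i => (x i).1, fun i => (x i).2, rfl, rfl, key N le_rfl⟩
  · intro Rd Rd' ωd ωd' h1 h2 h3 h4 H H' i
    induction i with
    | zero => exact fun _ => ⟨h1.trans h3.symm, h2.trans h4.symm⟩
    | succ i ih =>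
      intro hi
      obtain ⟨e1, e2⟩ := ih (by omega)
      have eR : Rd (i + 1) = Rd' (i + 1) := by
        rw [H.kinematics i hi, H'.kinematics i hi]
        simp only [e1, e2]
      refine ⟨eR, ?_⟩
      have hR0 : Rd 0 ∈ SO3 := h1 ▸ hR₀
      have hlen := hB h hh N hN _ _ hR0 h2 H i (by omega)
      have hSO := H.kinematics.mem_SO3 hR0 (i + 1) hi
      have hv' := H'.velocity i hi
      unfold VelocityUpdate at hv'
      rw [← eR, ← e2] at hv'
      exact (hu h hh hle _ (grid_mem_Icc hh hN hi) _ hSO _ hlen).unique (H.velocity i hi) hv'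

end Solvability

/-! ### Local errors and first-order convergence -/

section Convergence

attribute [local instance] Matrix.linftyOpNormedRing Matrix.linftyOpNormedAlgebra

variable {k : ℕ} {Φ : ℝ → ℝ} {m : ℝ} {D : Mat3} {M : ℝ → Measurement k} {t₀ T : ℝ}

theorem IsFilterSolution.hasDerivWithinAt {R : ℝ → Mat3} {ω : ℝ → Vec3} (hm : m ≠ 0)
    (H : IsFilterSolution Φ m D M t₀ T R ω) {t : ℝ} (ht : t ∈ Set.Icc t₀ T) :
    HasDerivWithinAt (fun s => (R s, ω s)) (filterField Φ m D (M t) (R t, ω t))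
      (Set.Icc t₀ T) t := by
  refine HasDerivWithinAt.prodMk ?_ ?_
  · have h := HasDerivWithinAt.fun_sum (u := Finset.univ) fun i (_ : i ∈ Finset.univ) =>
      HasDerivWithinAt.fun_sum (u := Finset.univ) fun j (_ : j ∈ Finset.univ) =>
        (H.attitude t ht i j).smul_const (Matrix.single i j (1 : ℝ))
    have e : ∀ A : Mat3, ∑ i, ∑ j, A i j • Matrix.single i j (1 : ℝ) = A := fun A => by
      conv_rhs => rw [Matrix.matrix_eq_sum_single A]
      simp only [Matrix.smul_single, smul_eq_mul, mul_one]
    exact (h.congr_deriv (e _)).congr (fun s _ => (e (R s)).symm) (e (R t)).symm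
  · have h := (H.velocity t ht).const_smul m⁻¹
    refine (h.congr_deriv ?_).congr (fun s _ => (inv_smul_smul₀ hm (ω s)).symm)
      (inv_smul_smul₀ hm (ω t)).symm
    change _ = m⁻¹ • ((M t).innovation Φ (R t) - D *ᵥ ω t) - hat ((M t).Ωm - ω t) *ᵥ ω t
    rw [hat_mulVec, add_sub_assoc, smul_add, smul_neg, inv_smul_smul₀ hm]
    abel

/-- Local truncation error of Euler's method along a solution of the continuous-time filter. -/
theorem exists_euler_error (hΦ : IsCostShape Φ) (hm : m ≠ 0)
    (hM : Measurement.LipschitzInTime M (Set.Icc t₀ T)) {R : ℝ → Mat3} {ω : ℝ → Vec3}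
    (H : IsFilterSolution Φ m D M t₀ T R ω) :
    ∃ C : ℝ, 0 ≤ C ∧ (∀ t ∈ Set.Icc t₀ T, ‖(R t, ω t)‖ ≤ C) ∧
      ∀ h : ℝ, 0 < h → ∀ t ∈ Set.Icc t₀ T, t + h ∈ Set.Icc t₀ T →
        ‖(R (t + h), ω (t + h)) - (R t, ω t) - h • filterField Φ m D (M t) (R t, ω t)‖ ≤
          C * h ^ 2 := by
  let x : ℝ → Mat3 × Vec3 := fun t => (R t, ω t)
  have hx : ∀ t ∈ Set.Icc t₀ T,
      HasDerivWithinAt x (filterField Φ m D (M t) (x t)) (Set.Icc t₀ T) t :=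
    fun t ht => H.hasDerivWithinAt hm ht
  obtain ⟨B, hB⟩ := isCompact_Icc.exists_bound_of_continuousOn
    fun t ht => (hx t ht).continuousWithinAt
  obtain ⟨C, hC0, hC1, hC2⟩ := exists_bound_filterField hΦ hM m D B
  have hlip : ∀ s ∈ Set.Icc t₀ T, ∀ t ∈ Set.Icc t₀ T, ‖x s - x t‖ ≤ C * |s - t| :=
    fun s hs t ht => (convex_Icc t₀ T).norm_image_sub_le_of_norm_hasDerivWithin_le hx
      (fun r hr => hC1 r hr _ (hB r hr)) ht hs
  refine ⟨max B (C * (1 + C)), le_max_of_le_right (by positivity),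
    fun t ht => (hB t ht).trans (le_max_left _ _), fun h hh t ht hth => ?_⟩
  have hsub : Set.Icc t (t + h) ⊆ Set.Icc t₀ T := Set.Icc_subset_Icc ht.1 hth.2
  -- With the Euler motion subtracted, the derivative is a difference of field values, of size
  -- `O(h)`; the mean value inequality supplies the second factor `h`. No second derivative is
  -- needed.
  have hy : ∀ s ∈ Set.Icc t (t + h), HasDerivWithinAt
      (fun s => x s - s • filterField Φ m D (M t) (x t))
      (filterField Φ m D (M s) (x s) - filterField Φ m D (M t) (x t)) (Set.Icc t (t + h)) s :=
    fun s hs => by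
      have := ((hx s (hsub hs)).mono hsub).sub
        ((hasDerivWithinAt_id s _).smul_const (filterField Φ m D (M t) (x t)))
      rw [one_smul] at this
      exact this
  have hb : ∀ s ∈ Set.Icc t (t + h),
      ‖filterField Φ m D (M s) (x s) - filterField Φ m D (M t) (x t)‖ ≤ C * (1 + C) * h :=
    fun s hs => by
      have h1 : |s - t| ≤ h := abs_le.mpr ⟨by linarith [hs.1], by linarith [hs.2]⟩
      calc _ ≤ C * (|s - t| + ‖x s - x t‖) :=
            hC2 s (hsub hs) t ht _ _ (hB s (hsub hs)) (hB t ht)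
        _ ≤ C * (h + C * h) := by
            gcongr
            exact (hlip s (hsub hs) t ht).trans (by gcongr)
        _ = _ := by ring
  have h1 := (convex_Icc t (t + h)).norm_image_sub_le_of_norm_hasDerivWithin_le hy hb
    (Set.left_mem_Icc.mpr (by linarith)) (Set.right_mem_Icc.mpr (by linarith))
  have e : x (t + h) - (t + h) • filterField Φ m D (M t) (x t)
      - (x t - t • filterField Φ m D (M t) (x t)) =
      x (t + h) - x t - h • filterField Φ m D (M t) (x t) := by
    rw [add_smul]
    abel
  rw [e, add_sub_cancel_left, Real.norm_of_nonneg hh.le, mul_assoc, ← sq] at h1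
  exact h1.trans (by gcongr; exact le_max_right _ _)

/-- One step of the discrete filter agrees with one step of Euler's method up to `O(h²)`. -/
theorem exists_discrete_error (hΦ : IsCostShape Φ) (hm : 0 < m) (D : Mat3)
    (hM : Measurement.LipschitzInTime M (Set.Icc t₀ T)) {B : ℝ} (hB : 0 ≤ B) :
    ∃ C h₀ : ℝ, 0 ≤ C ∧ 0 < h₀ ∧ ∀ h : ℝ, 0 < h → h ≤ h₀ →
      ∀ t ∈ Set.Icc t₀ T, t + h ∈ Set.Icc t₀ T → ∀ R ∈ SO3, ∀ R' ∈ SO3, ∀ ω ω' : Vec3,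
        ‖ω‖ ≤ B → ‖ω'‖ ≤ B →
        R' = R * NormedSpace.exp (h • hat ((M t).Ωm - ω)) →
        m • ω' = NormedSpace.exp (-h • hat ((M (t + h)).Ωm - ω')) *ᵥ
          ((m • (1 : Mat3) - h • D) *ᵥ ω + h • (M (t + h)).innovation Φ R') →
        ‖(R', ω') - (R, ω) - h • filterField Φ m D (M t) (R, ω)‖ ≤ C * h ^ 2 := by
  obtain ⟨r, C, hr, hC, hLip, hTaylor⟩ := exists_exp_estimates
  obtain ⟨G, hG0, hG, hGL⟩ := exists_bound_innovation hΦ hM 3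
  obtain ⟨K, hK0, hK, hKL⟩ := BddLipschitzOn.exists_norm_le_pi hM.bddLipschitzOn.2.2.2
  -- `A` bounds the matrices `Ω̂^×`, `γ` bounds the explicit acceleration `c`, and `K₁` below bounds
  -- the velocity increment divided by `h`.
  set A : ℝ := 3 * (K + B) with hA
  set γ : ℝ := m⁻¹ * (G + ‖D‖ * B) with hγ
  have hA0 : 0 ≤ A := by positivity
  have hγ0 : 0 ≤ γ := by positivity
  set K₁ : ℝ := C * A * (B + γ) + γ with hK₁
  refine ⟨max (3 * (C * A ^ 2)) (C * A ^ 2 * (B + γ) + A * γ + 3 * (K + K₁) * B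
    + m⁻¹ * (G * (1 + 3 * (C * A)))), min 1 (r / (A + 1)), le_max_of_le_left (by positivity),
    by positivity, fun h hh hle t ht hth R hR R' hR' ω ω' hω hω' hRR hωω => ?_⟩
  have hh1 : h ≤ 1 := hle.trans (min_le_left _ _)
  have hhr : h * A ≤ r := by
    have := (le_div_iff₀ (by positivity)).mp (hle.trans (min_le_right _ _))
    nlinarith
  have hnR := norm_le_of_mem_SO3 hR
  have hnR' := norm_le_of_mem_SO3 hR'
  set a := (M t).Ωm - ω with ha
  set a' := (M (t + h)).Ωm - ω' with ha'
  set g := (M t).innovation Φ R with hg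
  set g' := (M (t + h)).innovation Φ R' with hg'
  have hna : ‖hat a‖ ≤ A := (norm_hat_le _).trans
    (by rw [hA]; gcongr; exact (norm_sub_le _ _).trans (add_le_add (hK t ht) hω))
  have hna' : ‖hat a'‖ ≤ A := (norm_hat_le _).trans
    (by rw [hA]; gcongr; exact (norm_sub_le _ _).trans (add_le_add (hK _ hth) hω'))
  have hn : ‖h • hat a‖ ≤ h * A := by
    rw [norm_smul, Real.norm_of_nonneg hh.le]
    gcongr
  have hn' : ‖-h • hat a'‖ ≤ h * A := by
    rw [norm_smul, norm_neg, Real.norm_of_nonneg hh.le]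
    gcongr
  have hexp : ∀ X : Mat3, ‖X‖ ≤ h * A → ‖NormedSpace.exp X - 1‖ ≤ C * A * h := fun X hX => by
    have := hLip X 0 (hX.trans hhr) (by simpa using hr.le)
    rw [NormedSpace.exp_zero, sub_zero] at this
    calc _ ≤ C * (h * A) := this.trans (by gcongr)
      _ = _ := by ring
  have hexp2 : ∀ X : Mat3, ‖X‖ ≤ h * A → ‖NormedSpace.exp X - 1 - X‖ ≤ C * A ^ 2 * h ^ 2 :=
    fun X hX => by
      calc _ ≤ C * (h * A) ^ 2 := (hTaylor X (hX.trans hhr)).trans (by gcongr)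
        _ = _ := by ring
  have hdR : ‖R' - R‖ ≤ 3 * (C * A) * h := by
    have e : R' - R = R * (NormedSpace.exp (h • hat a) - 1) := by
      rw [hRR, Matrix.mul_sub, Matrix.mul_one]
    rw [e, mul_assoc]
    exact (norm_mul_le _ _).trans (mul_le_mul hnR (hexp _ hn) (norm_nonneg _) (by norm_num))
  set Q := NormedSpace.exp (-h • hat a') with hQ
  set c := m⁻¹ • (g' - D *ᵥ ω) with hc
  have hnc : ‖c‖ ≤ γ := by
    rw [hc, hγ, norm_smul, Real.norm_of_nonneg (by positivity)]
    gcongr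
    refine (norm_sub_le _ _).trans (add_le_add (hG _ hth _ hnR') ?_)
    exact (Matrix.linfty_opNorm_mulVec D ω).trans (by gcongr)
  have hω'eq : ω' = Q *ᵥ (ω + h • c) := by
    rw [← inv_smul_smul₀ hm.ne' ω', hωω, ← Matrix.mulVec_smul]
    congr 1
    rw [Matrix.sub_mulVec, Matrix.smul_mulVec, Matrix.smul_mulVec, Matrix.one_mulVec, hc,
      smul_add, smul_sub, inv_smul_smul₀ hm.ne', smul_sub, smul_sub]
    simp only [smul_comm m⁻¹ h]
    abel
  have hnb : ‖ω + h • c‖ ≤ B + γ := by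
    refine (norm_add_le _ _).trans (add_le_add hω ?_)
    rw [norm_smul, Real.norm_of_nonneg hh.le]
    calc h * ‖c‖ ≤ 1 * γ := by gcongr
      _ = γ := one_mul γ
  have hdω : ‖ω' - ω‖ ≤ K₁ * h := by
    have e : ω' - ω = (Q - 1) *ᵥ (ω + h • c) + h • c := by
      rw [Matrix.sub_mulVec, Matrix.one_mulVec, ← hω'eq]
      abel
    rw [e]
    calc _ ≤ ‖Q - 1‖ * ‖ω + h • c‖ + h * ‖c‖ := by
          refine (norm_add_le _ _).trans (add_le_add (Matrix.linfty_opNorm_mulVec _ _) ?_)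
          rw [norm_smul, Real.norm_of_nonneg hh.le]
      _ ≤ C * A * h * (B + γ) + h * γ := by
          gcongr
          exact hexp _ hn'
      _ = _ := by ring
  have hda : ‖a' - a‖ ≤ (K + K₁) * h := by
    have e : a' - a = ((M (t + h)).Ωm - (M t).Ωm) - (ω' - ω) := by
      rw [ha, ha']
      abel
    rw [e, add_mul]
    refine (norm_sub_le _ _).trans (add_le_add ((hKL _ hth t ht).trans ?_) hdω)
    rw [Real.dist_eq, add_sub_cancel_left, abs_of_pos hh]
  have hdg : ‖g' - g‖ ≤ G * (1 + 3 * (C * A)) * h := by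
    refine (hGL _ hth t ht R' R hnR' hnR).trans ?_
    rw [add_sub_cancel_left, abs_of_pos hh, mul_assoc, add_mul, one_mul]
    gcongr
  refine max_le ?_ ?_
  · change ‖R' - R - h • (R * hat a)‖ ≤ _
    have e : R' - R - h • (R * hat a) = R * (NormedSpace.exp (h • hat a) - 1 - h • hat a) := by
      rw [hRR, Matrix.mul_sub, Matrix.mul_sub, Matrix.mul_one, Matrix.mul_smul]
    rw [e]
    calc _ ≤ 3 * (C * A ^ 2 * h ^ 2) := (norm_mul_le _ _).trans
          (mul_le_mul hnR (hexp2 _ hn) (norm_nonneg _) (by norm_num))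
      _ = 3 * (C * A ^ 2) * h ^ 2 := by ring
      _ ≤ _ := by gcongr; exact le_max_left _ _
  · change ‖ω' - ω - h • (m⁻¹ • (g - D *ᵥ ω) - hat a *ᵥ ω)‖ ≤ _
    -- Four `O(h²)` defects: the exponential remainder, the second-order product of rotation and
    -- acceleration, and the changes of `Ω̂` and of the innovation caused by evaluating them at the
    -- end of the step.
    have e : ω' - ω - h • (m⁻¹ • (g - D *ᵥ ω) - hat a *ᵥ ω) =
        (Q - 1 - -h • hat a') *ᵥ (ω + h • c) - h • h • hat a' *ᵥ c - h • hat (a' - a) *ᵥ ω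
          + h • m⁻¹ • (g' - g) := by
      rw [Matrix.sub_mulVec, Matrix.sub_mulVec, ← hω'eq, Matrix.one_mulVec, Matrix.smul_mulVec,
        Matrix.mulVec_add, Matrix.mulVec_smul, hat_sub a' a, Matrix.sub_mulVec, hc]
      module
    rw [e]
    have n1 : ‖(Q - 1 - -h • hat a') *ᵥ (ω + h • c)‖ ≤ C * A ^ 2 * h ^ 2 * (B + γ) :=
      (Matrix.linfty_opNorm_mulVec _ _).trans
        (mul_le_mul (hexp2 _ hn') hnb (norm_nonneg _) (by positivity))
    have n2 : ‖h • h • hat a' *ᵥ c‖ ≤ h * (h * (A * γ)) := by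
      rw [norm_smul, norm_smul, Real.norm_of_nonneg hh.le]
      gcongr
      exact (Matrix.linfty_opNorm_mulVec _ _).trans (by gcongr)
    have n3 : ‖h • hat (a' - a) *ᵥ ω‖ ≤ h * (3 * ((K + K₁) * h) * B) := by
      rw [norm_smul, Real.norm_of_nonneg hh.le]
      gcongr
      refine (Matrix.linfty_opNorm_mulVec _ _).trans ?_
      gcongr
      exact (norm_hat_le _).trans (by gcongr)
    have n4 : ‖h • m⁻¹ • (g' - g)‖ ≤ h * (m⁻¹ * (G * (1 + 3 * (C * A)) * h)) := by
      rw [norm_smul, norm_smul, Real.norm_of_nonneg hh.le, Real.norm_of_nonneg (by positivity)]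
      gcongr
    calc _ ≤ C * A ^ 2 * h ^ 2 * (B + γ) + h * (h * (A * γ)) + h * (3 * ((K + K₁) * h) * B)
          + h * (m⁻¹ * (G * (1 + 3 * (C * A)) * h)) :=
          (norm_add_le _ _).trans (add_le_add ((norm_sub_le _ _).trans
            (add_le_add ((norm_sub_le _ _).trans (add_le_add n1 n2)) n3)) n4)
      _ = (C * A ^ 2 * (B + γ) + A * γ + 3 * (K + K₁) * B
            + m⁻¹ * (G * (1 + 3 * (C * A)))) * h ^ 2 := by ring
      _ ≤ _ := by gcongr; exact le_max_right _ _

theorem exists_global_error (hΦ : IsCostShape Φ) (hm : 0 < m)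
    (hM : Measurement.LipschitzInTime M (Set.Icc t₀ T)) (hT : t₀ < T)
    {R : ℝ → Mat3} {ω : ℝ → Vec3} (H : IsFilterSolution Φ m D M t₀ T R ω) :
    ∃ C h₀ : ℝ, 0 < h₀ ∧ ∀ h : ℝ, 0 < h → h ≤ h₀ → ∀ N : ℕ, t₀ + N * h ≤ T →
      ∀ (Rd : ℕ → Mat3) (ωd : ℕ → Vec3), Rd 0 = R t₀ → ωd 0 = ω t₀ →
        IsDiscreteFilter Φ m D h (fun i => M (t₀ + i * h)) N Rd ωd →
        ∀ i ≤ N, ‖(Rd i, ωd i) - (R (t₀ + i * h), ω (t₀ + i * h))‖ ≤ C * h := by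
  obtain ⟨B, hB0, hB⟩ := exists_length_bound hΦ hm D hM (ω t₀) hT
  obtain ⟨C₁, hC₁, hxB, hcont⟩ := exists_euler_error hΦ hm.ne' hM H
  obtain ⟨C₂, h₀, hC₂, hh₀, hdisc⟩ := exists_discrete_error hΦ hm D hM hB0
  -- The ball contains the exact trajectory (`C₁`) and every discrete run: `3` bounds the norm on
  -- `SO(3)`, `B` the velocities.
  obtain ⟨L, hL0, -, hL⟩ := exists_bound_filterField hΦ hM m D (max C₁ (max 3 B))
  refine ⟨(T - t₀) * (C₁ + C₂) * Real.exp ((T - t₀) * L), h₀, hh₀,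
    fun h hh hle N hN Rd ωd hR0 hω0 HD i hi => ?_⟩
  have hR0' : Rd 0 ∈ SO3 := hR0 ▸ H.init_mem
  have hSO := HD.kinematics.mem_SO3 hR0'
  have hlen : ∀ i ≤ N, ‖ωd i‖ ≤ B := fun i hi =>
    (norm_le_length _).trans (hB h hh N hN Rd ωd hR0' hω0 HD i hi)
  set u : ℕ → ℝ := fun i => ‖(Rd i, ωd i) - (R (t₀ + i * h), ω (t₀ + i * h))‖ with hu
  have step : ∀ i < N, u (i + 1) ≤ (1 + h * L) * u i + (C₁ + C₂) * h ^ 2 := fun i hi => by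
    have hi1 : i + 1 ≤ N := hi
    have ht := grid_mem_Icc hh hN hi.le
    have ht' := grid_mem_Icc hh hN hi1
    have hkin := HD.kinematics i hi
    have hvel := HD.velocity i hi
    unfold VelocityUpdate at hvel
    beta_reduce at hkin hvel
    simp only [hu]
    rw [grid_succ] at ht' hvel ⊢
    set t := t₀ + i * h
    have d1 := hdisc h hh hle t ht ht' _ (hSO i hi.le) _ (hSO _ hi1) _ _ (hlen i hi.le)
      (hlen _ hi1) hkin hvel
    have d2 := hcont h hh t ht ht'
    have d3 := hL t ht t ht (Rd i, ωd i) (R t, ω t)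
      ((max_le_max (norm_le_of_mem_SO3 (hSO i hi.le)) (hlen i hi.le)).trans (le_max_right _ _))
      ((hxB t ht).trans (le_max_left _ _))
    rw [sub_self, abs_zero, zero_add] at d3
    set x := (Rd i, ωd i)
    set x' := (Rd (i + 1), ωd (i + 1))
    set y := (R t, ω t)
    set y' := (R (t + h), ω (t + h))
    set f := filterField Φ m D (M t)
    -- Both increments are compared with Euler steps of the same field: the old error is amplified
    -- by at most `1 + h * L`, and the two local defects are added.
    have e : x' - y' = (x - y) + h • (f x - f y) + (x' - x - h • f x) - (y' - y - h • f y) := by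
      rw [smul_sub]
      abel
    rw [e]
    calc _ ≤ ‖x - y‖ + h * (L * ‖x - y‖) + C₂ * h ^ 2 + C₁ * h ^ 2 := by
          refine (norm_sub_le _ _).trans (add_le_add ((norm_add_le _ _).trans
            (add_le_add ((norm_add_le _ _).trans (add_le_add le_rfl ?_)) d1)) d2)
          rw [norm_smul, Real.norm_of_nonneg hh.le]
          gcongr
      _ = _ := by ring
  have hu0 : u 0 = 0 := by simp [hu, hR0, hω0]
  have h1 := le_of_le_one_add_mul_add (b := (C₁ + C₂) * h ^ 2) (c := h * L) (by positivity)
    (by positivity) hu0.ge step i hi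
  have hi' : i * h ≤ T - t₀ := by linarith [(grid_mem_Icc hh hN hi).2]
  rw [hu0, zero_add, ← mul_assoc (i : ℝ) h] at h1
  calc u i ≤ (i * h) * (C₁ + C₂) * Real.exp (i * h * L) * h := h1.trans (le_of_eq (by ring))
    _ ≤ _ := by gcongr

end Convergence

end AttitudeFilter

end

theorem mainTheorem5 (k : ℕ) (Φ : ℝ → ℝ) (hΦ : AttitudeFilter.IsCostShape Φ)
    (m : ℝ) (hm : 0 < m) (D : AttitudeFilter.Mat3) (hD : D.PosDef) :
    -- the discrete Lagrange-d'Alembert principle, with dissipation `τ_{i+1} = D ω_i`,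
    -- is equivalent to the discrete-time filter, whose attitudes stay on `SO(3)`
    (∀ (M : ℕ → AttitudeFilter.Measurement k) (h : ℝ), 0 < h →
      ∀ (N : ℕ) (R : ℕ → AttitudeFilter.Mat3) (Ωhat ω τ : ℕ → AttitudeFilter.Vec3),
        R 0 ∈ AttitudeFilter.SO3 →
        AttitudeFilter.DiscreteKinematics h (N + 1) R Ωhat →
        (∀ i, ω i = (M i).Ωm - Ωhat i) →
        (∀ i, τ (i + 1) = D *ᵥ ω i) →
        (∀ i ≤ N + 1, R i ∈ AttitudeFilter.SO3) ∧
        (AttitudeFilter.DiscreteLagrangeDAlembert Φ m h M (N + 1) R Ωhat τ ↔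
          AttitudeFilter.IsDiscreteFilter Φ m D h M N R ω)) ∧
    -- for small steps the implicit scheme is uniquely solvable,
    -- and its error with respect to the continuous-time filter is of first order in `h`
    (∀ (t₀ T : ℝ) (M : ℝ → AttitudeFilter.Measurement k)
      (R : ℝ → AttitudeFilter.Mat3) (ω : ℝ → AttitudeFilter.Vec3), t₀ < T →
      AttitudeFilter.Measurement.LipschitzInTime M (Set.Icc t₀ T) →
      AttitudeFilter.IsFilterSolution Φ m D M t₀ T R ω →
      ∃ C h₀ : ℝ, 0 < h₀ ∧ ∀ h : ℝ, 0 < h → h ≤ h₀ → ∀ N : ℕ, t₀ + N * h ≤ T →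
        (∃ (Rd : ℕ → AttitudeFilter.Mat3) (ωd : ℕ → AttitudeFilter.Vec3),
          Rd 0 = R t₀ ∧ ωd 0 = ω t₀ ∧
          AttitudeFilter.IsDiscreteFilter Φ m D h (fun i => M (t₀ + i * h)) N Rd ωd) ∧
        (∀ (Rd Rd' : ℕ → AttitudeFilter.Mat3) (ωd ωd' : ℕ → AttitudeFilter.Vec3),
          Rd 0 = R t₀ → ωd 0 = ω t₀ → Rd' 0 = R t₀ → ωd' 0 = ω t₀ →
          AttitudeFilter.IsDiscreteFilter Φ m D h (fun i => M (t₀ + i * h)) N Rd ωd →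
          AttitudeFilter.IsDiscreteFilter Φ m D h (fun i => M (t₀ + i * h)) N Rd' ωd' →
          ∀ i ≤ N, Rd i = Rd' i ∧ ωd i = ωd' i) ∧
        (∀ (Rd : ℕ → AttitudeFilter.Mat3) (ωd : ℕ → AttitudeFilter.Vec3),
          Rd 0 = R t₀ → ωd 0 = ω t₀ →
          AttitudeFilter.IsDiscreteFilter Φ m D h (fun i => M (t₀ + i * h)) N Rd ωd →
          ∀ i ≤ N, (∀ a b, |Rd i a b - R (t₀ + i * h) a b| ≤ C * h) ∧
            ‖ωd i - ω (t₀ + i * h)‖ ≤ C * h)) := by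
  refine ⟨fun M h hh N R Ωhat ω τ hR0 hk hω hτ => ⟨hk.mem_SO3 hR0,
    AttitudeFilter.discreteLagrangeDAlembert_iff hΦ hh hR0 hk hω hτ⟩, fun t₀ T M R ω hT hM H => ?_⟩
  obtain ⟨h₁, hh₁, hwell⟩ :=
    AttitudeFilter.exists_wellPosed hΦ hm D hM H.init_mem (ω t₀) hT
  obtain ⟨C, h₂, hh₂, herr⟩ := AttitudeFilter.exists_global_error hΦ hm hM hT H
  refine ⟨C, min h₁ h₂, lt_min hh₁ hh₂, fun h hh hle N hN => ?_⟩
  obtain ⟨hex, huniq⟩ := hwell h hh (hle.trans (min_le_left _ _)) N hN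
  refine ⟨hex, huniq, fun Rd ωd hR0 hω0 HD i hi => ?_⟩
  have key := herr h hh (hle.trans (min_le_right _ _)) N hN Rd ωd hR0 hω0 HD i hi
  exact ⟨fun a b => (AttitudeFilter.abs_apply_le_norm _ a b).trans ((le_max_left _ _).trans key),
    (le_max_right _ _).trans key⟩
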